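/- Let $n\ge 1$, and let $\mathcal H_{2n+1}$ be the Heisenberg group, i.e. $\mathbb R^n\times\mathbb R^n\times\mathbb R$ with coordinates $(x,y,z)$ and product $(x,y,z)(x',y',z')=(x+x',\,y+y',\,z+z'+\sum_i x_iy_i')$. Consider its left-invariant coframe $\sigma_i=dx_i$, $\rho_i=dy_i$, $\zeta=\sum_i x_i\,dy_i-dz$ and the dual frame $X_i=\partial_{x_i}$, $Y_i=\partial_{y_i}+x_i\partial_z$, $Z=-\partial_z$. For $s>0$ put $$F_n(s)=2(-1)^{n+1}(n+1)!\,\frac1s\Big[\sum_{k=0}^{n+1}\frac{(-1)^k}{k!}s^k-e^{-s}\Big].$$ Let $q_0\in\mathbb R$, $\phi_0>0$ and $$q_a=q_0-\int_0^{\phi_0}\frac{ds}{F_n(s)}\in[-\infty,q_0),\qquad q_b=q_0+\int_{\phi_0}^{\infty}\frac{ds}{F_n(s)}\in(q_0,\infty].$$ Then the initial value problem $\phi'=F_n(\phi)$, $\phi(q_0)=\phi_0$ has a solution $\phi$ on $(q_a,q_b)$. This solution is unique and maximal: every solution of the problem on an open interval containing $q_0$ is a restriction of it. Moreover, $\phi$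 maps $(q_a,q_b)$ bijectively onto $(0,\infty)$. On $M=\mathcal H_{2n+1}\times(q_a,q_b)$ consider $$g=\sum_{i=1}^n\phi(q)\,(\sigma_i^2+\rho_i^2)+\frac{\phi'(q)}{\phi(q)^{n-1}}\,\zeta^2+\phi(q)^{n-1}\phi'(q)\,dq^2,$$ the almost complex structure $J$ with $JX_i=Y_i$ and $J\partial_q=\phi(q)^{n-1}Z$, and $f=-\phi(q)+c$ with any constant $c\in\mathbb R$. Then $(g,f)$ is a complete expanding gradient Kähler–Ricci soliton on $(M,J)$ with soliton constant $\lambda=-1$. That is, $(M,g,J)$ is a Kähler manifold, $g$ is complete, the vector field $\nabla f$ is holomorphic, and $$\mathrm{Ric}+\nabla df=-g .$$ In terms of the function $\phi$, the metric is given explicitly by $$g=\sum_{i=1}^n\phi\,(\sigma_i^2+\rho_i^2)+\frac{F_n(\phi)}{\phi^{n-1}}\,\zeta^2+\frac{\phi^{n-1}}{F_n(\phi)}\,d\phi^2 .$$ -/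

import Mathlib

open scoped ENNReal ContDiff

set_option maxSynthPendingDepth 3

/-! ## Riemannian and Kähler geometry on an open subset of a real vector space

Everything is written in the single global chart given by the vector space `V`; tangent vectors at
a point of `U ⊆ V` are elements of `V`, and vectors `u v w : V` double as the constant (coordinate)
vector fields. -/

namespace ChartGeometry

noncomputable section

variable {V : Type*} [NormedAddCommGroup V] [NormedSpace ℝ V]

/-- `g` is a smooth Riemannian metric on the open set `U`. -/
structure IsRiemannianMetricOn (U : Set V) (g : V → V →L[ℝ] V →L[ℝ] ℝ) : Prop where
  isOpen : IsOpen U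
  smooth : ContDiffOn ℝ ∞ g U
  symm : ∀ p ∈ U, ∀ u v, g p u v = g p v u
  pos : ∀ p ∈ U, ∀ v, v ≠ 0 → 0 < g p v v

/-- The covector `w ↦ ½ (∂_u g(v,w) + ∂_v g(u,w) - ∂_w g(u,v))`, bilinear in `u, v`
(Christoffel symbols of the first kind). -/
def koszul (g : V → V →L[ℝ] V →L[ℝ] ℝ) (p : V) : V →L[ℝ] V →L[ℝ] V →L[ℝ] ℝ :=
  (1 / 2 : ℝ) • (fderiv ℝ g p + (fderiv ℝ g p).flip
    - ((ContinuousLinearMap.flipₗᵢ ℝ V V ℝ).toContinuousLinearEquiv.toContinuousLinearMap).comp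
        (fderiv ℝ g p).flip)

theorem koszul_apply (g : V → V →L[ℝ] V →L[ℝ] ℝ) (p u v w : V) :
    koszul g p u v w =
      1 / 2 * (fderiv ℝ g p u v w + fderiv ℝ g p v u w - fderiv ℝ g p w u v) := by
  simp [koszul]

/-- Christoffel symbols `Γ(u,v)` of the Levi-Civita connection: `g(Γ(u,v), w) = koszul(u,v)(w)`.
Here `(g p).inverse` is the musical isomorphism `V* → V` of the nondegenerate form `g p`. -/
def christoffel (g : V → V →L[ℝ] V →L[ℝ] ℝ) (p : V) : V →L[ℝ] V →L[ℝ] V :=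
  (ContinuousLinearMap.compL ℝ V (V →L[ℝ] ℝ) V (g p).inverse).comp (koszul g p)

theorem christoffel_apply (g : V → V →L[ℝ] V →L[ℝ] ℝ) (p u v : V) :
    christoffel g p u v = (g p).inverse (koszul g p u v) := rfl

/-- The endomorphism `u ↦ R(u,v)w = ∇_u ∇_v w - ∇_v ∇_u w` (for constant fields `u, v, w`). -/
def curvature (g : V → V →L[ℝ] V →L[ℝ] ℝ) (p v w : V) : V →L[ℝ] V :=
  ((fderiv ℝ (christoffel g) p).flip v).flip w - (fderiv ℝ (christoffel g) p v).flip w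
    + (christoffel g p).flip (christoffel g p v w)
    - (christoffel g p v).comp ((christoffel g p).flip w)

theorem curvature_apply (g : V → V →L[ℝ] V →L[ℝ] ℝ) (p u v w : V) :
    curvature g p v w u =
      fderiv ℝ (christoffel g) p u v w - fderiv ℝ (christoffel g) p v u w
        + christoffel g p u (christoffel g p v w) - christoffel g p v (christoffel g p u w) := rfl

/-- The Ricci tensor `Ric(v,w) = tr (u ↦ R(u,v)w)`. -/
def ricci (g : V → V →L[ℝ] V →L[ℝ] ℝ) (p v w : V) : ℝ :=
  LinearMap.trace ℝ V (curvature g p v w : V →ₗ[ℝ] V)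

/-- The Hessian `∇df` of a function with respect to the Levi-Civita connection. -/
def hessian (g : V → V →L[ℝ] V →L[ℝ] ℝ) (f : V → ℝ) (p u v : V) : ℝ :=
  fderiv ℝ (fderiv ℝ f) p u v - fderiv ℝ f p (christoffel g p u v)

/-- The gradient `∇f`. -/
def gradient (g : V → V →L[ℝ] V →L[ℝ] ℝ) (f : V → ℝ) (p : V) : V :=
  (g p).inverse (fderiv ℝ f p)

/-- The fundamental form `ω(u,v) = g(Ju,v)`. -/
def kahlerForm (g : V → V →L[ℝ] V →L[ℝ] ℝ) (J : V → V →L[ℝ] V) (p : V) : V →L[ℝ] V →L[ℝ] ℝ :=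
  (g p).comp (J p)

/-- The Nijenhuis tensor `[Ju,Jv] - J[Ju,v] - J[u,Jv] - [u,v]`, where `[u,v] = 0` for the
constant fields `u, v`. -/
def nijenhuis (J : V → V →L[ℝ] V) (p u v : V) : V :=
  VectorField.lieBracket ℝ (fun y => J y u) (fun y => J y v) p
    - J p (VectorField.lieBracket ℝ (fun y => J y u) (fun _ => v) p)
    - J p (VectorField.lieBracket ℝ (fun _ => u) (fun y => J y v) p)

/-- `(U, g, J)` is a Kähler manifold: `g` is a Riemannian metric, `J` a smooth integrable almost
complex structure which is orthogonal for `g`, and the Kähler form is closed. -/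
structure IsKahlerOn (U : Set V) (g : V → V →L[ℝ] V →L[ℝ] ℝ) (J : V → V →L[ℝ] V) : Prop where
  riemannian : IsRiemannianMetricOn U g
  smooth_J : ContDiffOn ℝ ∞ J U
  sq_J : ∀ p ∈ U, ∀ u, J p (J p u) = -u
  hermitian : ∀ p ∈ U, ∀ u v, g p (J p u) (J p v) = g p u v
  integrable : ∀ p ∈ U, ∀ u v, nijenhuis J p u v = 0
  closed : ∀ p ∈ U, ∀ u v w,
    fderiv ℝ (kahlerForm g J) p u v w + fderiv ℝ (kahlerForm g J) p v w u
      + fderiv ℝ (kahlerForm g J) p w u v = 0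

/-- `(g, f)` is a gradient Kähler-Ricci soliton on `(U, J)` with soliton constant `lam`:
`(U, g, J)` is Kähler, `f` is smooth, `Ric + ∇df = lam g`, and `X = ∇f` is (real) holomorphic, that
is `(L_X J) u = [X, Ju] - J[X, u] = 0`. -/
structure IsGradientKahlerRicciSoliton (U : Set V) (g : V → V →L[ℝ] V →L[ℝ] ℝ)
    (J : V → V →L[ℝ] V) (f : V → ℝ) (lam : ℝ) : Prop where
  kahler : IsKahlerOn U g J
  smooth_f : ContDiffOn ℝ ∞ f U
  soliton : ∀ p ∈ U, ∀ u v, ricci g p u v + hessian g f p u v = lam * g p u v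
  holomorphic : ∀ p ∈ U, ∀ u,
    VectorField.lieBracket ℝ (gradient g f) (fun y => J y u) p
      - J p (VectorField.lieBracket ℝ (gradient g f) (fun _ => u) p) = 0

/-- The length of a curve `γ : [0,1] → V`. -/
def curveLength (g : V → V →L[ℝ] V →L[ℝ] ℝ) (γ : ℝ → V) : ℝ≥0∞ :=
  ∫⁻ t in Set.Icc (0 : ℝ) 1, ENNReal.ofReal
    (Real.sqrt (g (γ t) (derivWithin γ (Set.Icc 0 1) t) (derivWithin γ (Set.Icc 0 1) t)))

/-- The Riemannian distance of `(U, g)`: infimum of the lengths of the `C¹` curves in `U` from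
`p` to `q`. -/
def riemDist (U : Set V) (g : V → V →L[ℝ] V →L[ℝ] ℝ) (p q : V) : ℝ≥0∞ :=
  ⨅ (γ : ℝ → V) (_ : ContDiffOn ℝ 1 γ (Set.Icc 0 1) ∧ Set.MapsTo γ (Set.Icc 0 1) U ∧
    γ 0 = p ∧ γ 1 = q), curveLength g γ

/-- `(U, g)` is complete: every Cauchy sequence for the Riemannian distance converges in `U`. -/
def IsCompleteOn (U : Set V) (g : V → V →L[ℝ] V →L[ℝ] ℝ) : Prop :=
  ∀ s : ℕ → V, (∀ m, s m ∈ U) →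
    (∀ ε : ℝ≥0∞, 0 < ε → ∃ N, ∀ m ≥ N, ∀ k ≥ N, riemDist U g (s m) (s k) < ε) →
    ∃ p ∈ U, Filter.Tendsto (fun m => riemDist U g (s m) p) Filter.atTop (nhds 0)

end

end ChartGeometry

/-! ## The Heisenberg group and the cohomogeneity one metrics -/

namespace Heisenberg

noncomputable section

/-- The Heisenberg group of dimension `2n+1`, in its global coordinates `(x, y, z)`. -/
def Heis (n : ℕ) : Type := (Fin n → ℝ) × (Fin n → ℝ) × ℝ

instance (n : ℕ) : NormedAddCommGroup (Heis n) :=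
  inferInstanceAs (NormedAddCommGroup ((Fin n → ℝ) × (Fin n → ℝ) × ℝ))

instance (n : ℕ) : NormedSpace ℝ (Heis n) :=
  inferInstanceAs (NormedSpace ℝ ((Fin n → ℝ) × (Fin n → ℝ) × ℝ))

instance (n : ℕ) : FiniteDimensional ℝ (Heis n) :=
  inferInstanceAs (FiniteDimensional ℝ ((Fin n → ℝ) × (Fin n → ℝ) × ℝ))

/-- The coordinates `(x, y, z)` as a linear isomorphism; `(coord n).symm` assembles a point. -/
def coord (n : ℕ) : Heis n ≃L[ℝ] (Fin n → ℝ) × (Fin n → ℝ) × ℝ :=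
  ContinuousLinearEquiv.refl ℝ ((Fin n → ℝ) × (Fin n → ℝ) × ℝ)

/-- Multiplication of the matrices `[1 x z; 0 Iₙ y; 0 0 1]`:
`(x,y,z)(x',y',z') = (x + x', y + y', z + z' + ∑ xᵢ y'ᵢ)`. -/
instance (n : ℕ) : Group (Heis n) where
  mul a b := (coord n).symm (a.1 + b.1, a.2.1 + b.2.1, a.2.2 + b.2.2 + ∑ i, a.1 i * b.2.1 i)
  one := (coord n).symm (0, 0, 0)
  inv a := (coord n).symm (-a.1, -a.2.1, -a.2.2 + ∑ i, a.1 i * a.2.1 i)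
  mul_assoc a b c := by
    refine Prod.ext (add_assoc _ _ _) (Prod.ext (add_assoc _ _ _) ?_)
    change (a.2.2 + b.2.2 + ∑ i, a.1 i * b.2.1 i) + c.2.2 + ∑ i, (a.1 i + b.1 i) * c.2.1 i
      = a.2.2 + (b.2.2 + c.2.2 + ∑ i, b.1 i * c.2.1 i) + ∑ i, a.1 i * (b.2.1 i + c.2.1 i)
    simp only [add_mul, mul_add, Finset.sum_add_distrib]
    ring
  one_mul a := by
    refine Prod.ext (zero_add _) (Prod.ext (zero_add _) ?_)
    change 0 + a.2.2 + ∑ i, (0 : ℝ) * a.2.1 i = a.2.2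
    simp
  mul_one a := by
    refine Prod.ext (add_zero _) (Prod.ext (add_zero _) ?_)
    change a.2.2 + 0 + ∑ i, a.1 i * (0 : ℝ) = a.2.2
    simp
  inv_mul_cancel a := by
    refine Prod.ext (neg_add_cancel _) (Prod.ext (neg_add_cancel _) ?_)
    change (-a.2.2 + ∑ i, a.1 i * a.2.1 i) + a.2.2 + ∑ i, -a.1 i * a.2.1 i = 0
    simp

/-- The product of the Heisenberg group with the `q`-line, of dimension `2n+2`. -/
abbrev Amb (n : ℕ) : Type := Heis n × ℝ

/-- The `1`-form `σᵢ = dxᵢ`; as a linear form on points it is also the coordinate `xᵢ`. -/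
def sigma {n : ℕ} (i : Fin n) : Amb n →L[ℝ] ℝ :=
  (ContinuousLinearMap.proj i).comp ((ContinuousLinearMap.fst ℝ (Fin n → ℝ) ((Fin n → ℝ) × ℝ)).comp
    ((coord n : Heis n →L[ℝ] _).comp (ContinuousLinearMap.fst ℝ (Heis n) ℝ)))

/-- The `1`-form `ρᵢ = dyᵢ`. -/
def rho {n : ℕ} (i : Fin n) : Amb n →L[ℝ] ℝ :=
  (ContinuousLinearMap.proj i).comp ((ContinuousLinearMap.fst ℝ (Fin n → ℝ) ℝ).comp
    ((ContinuousLinearMap.snd ℝ (Fin n → ℝ) ((Fin n → ℝ) × ℝ)).comp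
      ((coord n : Heis n →L[ℝ] _).comp (ContinuousLinearMap.fst ℝ (Heis n) ℝ))))

/-- The `1`-form `dz`. -/
def dz (n : ℕ) : Amb n →L[ℝ] ℝ :=
  (ContinuousLinearMap.snd ℝ (Fin n → ℝ) ℝ).comp
    ((ContinuousLinearMap.snd ℝ (Fin n → ℝ) ((Fin n → ℝ) × ℝ)).comp
      ((coord n : Heis n →L[ℝ] _).comp (ContinuousLinearMap.fst ℝ (Heis n) ℝ)))

/-- The `1`-form `dq`. -/
def dq (n : ℕ) : Amb n →L[ℝ] ℝ := ContinuousLinearMap.snd ℝ (Heis n) ℝ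

/-- The `1`-form `ζ = ∑ xᵢ dyᵢ - dz`. -/
def zeta {n : ℕ} (p : Amb n) : Amb n →L[ℝ] ℝ := ∑ i, sigma i p • rho i - dz n

/-- The frame field `Xᵢ = ∂_{xᵢ}`. -/
def vecX {n : ℕ} (i : Fin n) : Amb n := ((coord n).symm (Pi.single i 1, 0, 0), 0)

/-- The frame field `Yᵢ = ∂_{yᵢ} + xᵢ ∂_z`. -/
def vecY {n : ℕ} (i : Fin n) (p : Amb n) : Amb n :=
  ((coord n).symm (0, Pi.single i 1, sigma i p), 0)

/-- The frame field `Z = -∂_z`. -/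
def vecZ (n : ℕ) : Amb n := ((coord n).symm (0, 0, -1), 0)

/-- The frame field `∂_q`. -/
def vecQ (n : ℕ) : Amb n := (0, 1)

/-- The square `α² = α ⊗ α` of a `1`-form. -/
def sq {n : ℕ} (α : Amb n →L[ℝ] ℝ) : Amb n →L[ℝ] Amb n →L[ℝ] ℝ := α.smulRight α

/-- The metric `g = ∑ φ (σᵢ² + ρᵢ²) + (φ' / φ^{n-1}) ζ² + φ^{n-1} φ' dq²`, `φ = φ(q)`. -/
def metric (n : ℕ) (φ : ℝ → ℝ) (p : Amb n) : Amb n →L[ℝ] Amb n →L[ℝ] ℝ :=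
  (∑ i : Fin n, φ p.2 • (sq (sigma i) + sq (rho i)))
    + (deriv φ p.2 / φ p.2 ^ (n - 1)) • sq (zeta p)
    + (φ p.2 ^ (n - 1) * deriv φ p.2) • sq (dq n)

/-- The almost complex structure with `J Xᵢ = Yᵢ` and `J ∂_q = φ^{n-1} Z`. -/
def cplx (n : ℕ) (φ : ℝ → ℝ) (p : Amb n) : Amb n →L[ℝ] Amb n :=
  (∑ i : Fin n, ((sigma i).smulRight (vecY i p) - (rho i).smulRight (vecX i)))
    + φ p.2 ^ (n - 1) • (dq n).smulRight (vecZ n)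
    - (φ p.2 ^ (n - 1))⁻¹ • (zeta p).smulRight (vecQ n)

/-- Left multiplication by the Heisenberg group on `H × ℝ`. -/
def leftMul {n : ℕ} (a : Heis n) (p : Amb n) : Amb n := (a * p.1, p.2)

/-- `F_n(s) = 2 (-1)^{n+1} (n+1)! (1/s) [∑_{k=0}^{n+1} (-1)^k s^k / k! - e^{-s}]`. -/
def F (n : ℕ) (s : ℝ) : ℝ :=
  2 * (-1) ^ (n + 1) * (Nat.factorial (n + 1) : ℝ) * (1 / s) *
    (∑ k ∈ Finset.range (n + 2), (-1) ^ k / (Nat.factorial k : ℝ) * s ^ k - Real.exp (-s))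

/-- The left end `q_a = q₀ - ∫_0^{φ₀} ds / F_n(s)`, possibly `-∞`. -/
def qa (n : ℕ) (q₀ φ₀ : ℝ) : EReal :=
  (q₀ : EReal) - ((∫⁻ s in Set.Ioo 0 φ₀, ENNReal.ofReal (1 / F n s) : ℝ≥0∞) : EReal)

/-- The right end `q_b = q₀ + ∫_{φ₀}^∞ ds / F_n(s)`, possibly `+∞`. -/
def qb (n : ℕ) (q₀ φ₀ : ℝ) : EReal :=
  (q₀ : EReal) + ((∫⁻ s in Set.Ioi φ₀, ENNReal.ofReal (1 / F n s) : ℝ≥0∞) : EReal)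

/-- The interval `(q_a, q_b)`. -/
def interval (n : ℕ) (q₀ φ₀ : ℝ) : Set ℝ := {q : ℝ | qa n q₀ φ₀ < q ∧ (q : EReal) < qb n q₀ φ₀}

/-- `φ` solves `φ' = F_n(φ)`, `φ(q₀) = φ₀`, on the set `I`. -/
def IsSolution (n : ℕ) (q₀ φ₀ : ℝ) (I : Set ℝ) (φ : ℝ → ℝ) : Prop :=
  φ q₀ = φ₀ ∧ ∀ q ∈ I, HasDerivAt φ (F n (φ q)) q

/-- The manifold `M = H_{2n+1} × (q_a, q_b)`. -/
def manifoldM (n : ℕ) (q₀ φ₀ : ℝ) : Set (Amb n) := {p | p.2 ∈ interval n q₀ φ₀}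

theorem leftMul_eq {n : ℕ} (a : Heis n) :
    leftMul a = fun p => (a, (0 : ℝ)) + (p - (∑ i, a.1 i * rho i p) • vecZ n) := by
  funext p
  refine Prod.ext (Prod.ext ?_ (Prod.ext ?_ ?_)) ?_
  · change a.1 + p.1.1 = a.1 + (p.1.1 - (∑ i, a.1 i * rho i p) • (0 : Fin n → ℝ))
    simp
  · change a.2.1 + p.1.2.1 = a.2.1 + (p.1.2.1 - (∑ i, a.1 i * rho i p) • (0 : Fin n → ℝ))
    simp
  · change a.2.2 + p.1.2.2 + ∑ i, a.1 i * rho i p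
      = a.2.2 + (p.1.2.2 - (∑ i, a.1 i * rho i p) * (-1))
    ring
  · change p.2 = 0 + (p.2 - (∑ i, a.1 i * rho i p) * 0)
    ring

theorem fderiv_leftMul {n : ℕ} (a : Heis n) (p v : Amb n) :
    fderiv ℝ (leftMul a) p v = v - (∑ i, a.1 i * rho i v) • vecZ n := by
  have h : HasFDerivAt (leftMul a) (ContinuousLinearMap.id ℝ (Amb n)
      - (∑ i, a.1 i • rho i).smulRight (vecZ n)) p := by
    have h0 := (((ContinuousLinearMap.id ℝ (Amb n)
      - (∑ i, a.1 i • rho i).smulRight (vecZ n)).hasFDerivAt (x := p)).const_add (a, (0 : ℝ)))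
    rw [leftMul_eq]
    simpa using h0
  rw [h.fderiv]
  simp

/-- The coframe `σᵢ, ρᵢ, ζ, dq` is invariant under left multiplication. -/
theorem coframe_leftInvariant {n : ℕ} (a : Heis n) (p v : Amb n) :
    (∀ i, sigma i (fderiv ℝ (leftMul a) p v) = sigma i v) ∧
    (∀ i, rho i (fderiv ℝ (leftMul a) p v) = rho i v) ∧
    zeta (leftMul a p) (fderiv ℝ (leftMul a) p v) = zeta p v ∧
    dq n (fderiv ℝ (leftMul a) p v) = dq n v := by
  have h1 : ∀ i, sigma i (vecZ n) = 0 := fun _ => rfl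
  have h2 : ∀ i, rho i (vecZ n) = 0 := fun _ => rfl
  have h3 : dz n (vecZ n) = -1 := rfl
  have h4 : dq n (vecZ n) = 0 := rfl
  have h5 : ∀ i, sigma i (leftMul a p) = a.1 i + sigma i p := fun _ => rfl
  rw [fderiv_leftMul]
  refine ⟨fun i => by simp [h1], fun i => by simp [h2], ?_, by simp [h4]⟩
  simp [zeta, h2, h3, h5, add_mul, Finset.sum_add_distrib]
  ring

/-- The vectors `Xᵢ, Yᵢ, Z, ∂_q` are dual to `σᵢ, ρᵢ, ζ, dq`. -/
theorem frame_dual {n : ℕ} (p : Amb n) (i j : Fin n) :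
    (sigma i (vecX j : Amb n) = if i = j then 1 else 0) ∧ sigma i (vecY j p) = 0 ∧
    sigma i (vecZ n) = 0 ∧ sigma i (vecQ n) = 0 ∧
    rho i (vecX j : Amb n) = 0 ∧ (rho i (vecY j p) = if i = j then 1 else 0) ∧
    rho i (vecZ n) = 0 ∧ rho i (vecQ n) = 0 ∧
    zeta p (vecX j) = 0 ∧ zeta p (vecY j p) = 0 ∧ zeta p (vecZ n) = 1 ∧ zeta p (vecQ n) = 0 ∧
    dq n (vecX j) = 0 ∧ dq n (vecY j p) = 0 ∧ dq n (vecZ n) = 0 ∧ dq n (vecQ n) = 1 := by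
  have a1 : ∀ k, sigma k (vecX j : Amb n) = if k = j then 1 else 0 :=
    fun k => Pi.single_apply j (1 : ℝ) k
  have b1 : ∀ k, rho k (vecX j : Amb n) = 0 := fun _ => rfl
  have b2 : ∀ k, rho k (vecY j p) = if k = j then 1 else 0 :=
    fun k => Pi.single_apply j (1 : ℝ) k
  have b3 : ∀ k, rho k (vecZ n) = 0 := fun _ => rfl
  have b4 : ∀ k, rho k (vecQ n) = 0 := fun _ => rfl
  have c1 : dz n (vecX j) = 0 := rfl
  have c2 : dz n (vecY j p) = sigma j p := rfl
  have c3 : dz n (vecZ n) = -1 := rfl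
  have c4 : dz n (vecQ n) = 0 := rfl
  refine ⟨a1 i, rfl, rfl, rfl, b1 i, b2 i, b3 i, b4 i, ?_, ?_, ?_, ?_, rfl, rfl, rfl, rfl⟩
  · simp [zeta, b1, c1]
  · simp [zeta, b2, c2]
  · simp [zeta, b3, c3]
  · simp [zeta, b4, c4]

end

end Heisenberg

/-! The whole construction rests on two facts about `F n` on the positive half line: the linear
equation `F' = 2 s ^ n - F - F / s`, and the bounds `0 < F n s ≤ s ^ (n + 1)`. Both come from
`hasDerivAt_sF`, where `sF n s = s * F n s` solves `y' + y = 2 s ^ (n + 1)` with `y 0 = 0`, so that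
`exp s` is an integrating factor.

The initial value problem is solved by separation of variables. With `T(s) = ∫ 1 / F` from `φ₀` to
`s` (`travelTime`), a strictly increasing function, the interval `(q_a, q_b)` is exactly `q₀ + T((0,
∞))` (`mem_interval_iff`), and a solution is the inverse of `q₀ + T`. Any other solution stays
positive (`IsSolution.pos`), hence satisfies the same implicit equation; this gives uniqueness,
maximality and bijectivity together.

The geometry is computed for all metrics `A ∑ (σᵢ² + ρᵢ²) + B ζ² + C dq²` with coefficients
depending on `q`. A candidate for the Levi-Civita connection is checked against the Koszul formula
(`DiagData.koszul_eq`), and the Ricci tensor, obtained by a trace in the frame, is diagonal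
(`DiagData.ricci_eq`). If `J ∂_q = m Z`, orthogonality of `J` is `C = m² B` and closedness of the
Kähler form is `A' = m B`. In the case at hand the form is `d(φ ζ)`. The gradient of `-φ + c` is `J
Z = -φ^{-(n-1)} ∂_q`, which is holomorphic. The soliton equation becomes three scalar identities;
the horizontal one is precisely the linear equation for `F n`, and the other two follow from it and
its derivative (`IsSolution.soliton_equation`).

For completeness, `F n s ≤ s ^ (n + 1)` says that `log φ` has gradient of length at most one. Along
a Cauchy sequence, and along short curves from its points, `φ` therefore stays in a compact part of
`(0, ∞)`, where the metric dominates a left-invariant one. Then `x`, `y`, `q` converge; since `x` is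
bounded, `dz = ∑ xᵢ dyᵢ - ζ` is controlled too, and `z` converges. The limit of `q` lies in the
interval because `log φ` has a finite limit. -/

namespace Heisenberg

/-! ### The function `F n`: its linear equation and its bounds. -/

/-- Taylor polynomials of `exp (-s)`. -/
theorem hasDerivAt_sum_neg_pow_div_factorial (m : ℕ) (s : ℝ) :
    HasDerivAt (fun s : ℝ => ∑ k ∈ Finset.range (m + 1), (-1) ^ k / (Nat.factorial k : ℝ) * s ^ k)
      (-∑ k ∈ Finset.range m, (-1) ^ k / (Nat.factorial k : ℝ) * s ^ k) s := by
  induction m with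
  | zero => simpa using hasDerivAt_const s (1 : ℝ)
  | succ m ih =>
    have h := ih.add ((hasDerivAt_pow (m + 1) s).const_mul
      ((-1) ^ (m + 1) / (Nat.factorial (m + 1) : ℝ)))
    have e : (fun s : ℝ => ∑ k ∈ Finset.range (m + 1 + 1),
        (-1) ^ k / (Nat.factorial k : ℝ) * s ^ k) =
        (fun s : ℝ => ∑ k ∈ Finset.range (m + 1), (-1) ^ k / (Nat.factorial k : ℝ) * s ^ k) +
          fun s : ℝ => (-1) ^ (m + 1) / (Nat.factorial (m + 1) : ℝ) * s ^ (m + 1) := by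
      funext x
      rw [Pi.add_apply, Finset.sum_range_succ]
    rw [e]
    refine h.congr_deriv ?_
    rw [Finset.sum_range_succ, Nat.factorial_succ]
    have : (Nat.factorial m : ℝ) ≠ 0 := by positivity
    push_cast
    field_simp
    simp
    ring

/-- The entire function `s F_n(s)`. -/
noncomputable def sF (n : ℕ) (s : ℝ) : ℝ :=
  2 * (-1) ^ (n + 1) * (Nat.factorial (n + 1) : ℝ) *
    (∑ k ∈ Finset.range (n + 2), (-1) ^ k / (Nat.factorial k : ℝ) * s ^ k - Real.exp (-s))

theorem F_eq_sF_div (n : ℕ) (s : ℝ) : F n s = sF n s / s := by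
  rw [F, sF]; ring

theorem sF_zero (n : ℕ) : sF n 0 = 0 := by
  simp [sF, Finset.sum_range_succ']

/-- Differentiation turns the Taylor polynomial of `exp (-s)` into minus the one of degree one less.
Only the top term is left over, and the factor `(n + 1)!` with its sign normalizes that term to `2 *
s ^ (n + 1)`. -/
theorem hasDerivAt_sF (n : ℕ) (s : ℝ) : HasDerivAt (sF n) (2 * s ^ (n + 1) - sF n s) s := by
  have h := ((hasDerivAt_sum_neg_pow_div_factorial (n + 1) s).sub
    (hasDerivAt_neg s).exp).const_mul (2 * (-1) ^ (n + 1) * (Nat.factorial (n + 1) : ℝ))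
  refine h.congr_deriv ?_
  rw [sF, Finset.sum_range_succ _ (n + 1)]
  have : (Nat.factorial (n + 1) : ℝ) ≠ 0 := by positivity
  have h1 : ((-1 : ℝ) ^ (n + 1)) * (-1) ^ (n + 1) = 1 := by
    rw [← mul_pow]; simp
  field_simp
  linear_combination s ^ (n + 1) * h1

/-- With the integrating factor `exp x`, the derivative `2 x ^ (n + 1) exp x` is positive for `x >
0`, and the product starts from `0`. -/
theorem sF_pos (n : ℕ) {s : ℝ} (hs : 0 < s) : 0 < sF n s := by
  have hd : ∀ x, HasDerivAt (fun x => sF n x * Real.exp x) (2 * x ^ (n + 1) * Real.exp x) x :=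
    fun x => ((hasDerivAt_sF n x).mul (Real.hasDerivAt_exp x)).congr_deriv (by ring)
  have h := strictMonoOn_of_deriv_pos (convex_Ici (0 : ℝ))
    (fun x _ => (hd x).continuousAt.continuousWithinAt)
    (fun x hx => by
      rw [interior_Ici] at hx
      rw [(hd x).deriv]
      have : (0 : ℝ) < x := hx
      positivity) Set.self_mem_Ici hs.le hs
  simp only [sF_zero, zero_mul] at h
  exact pos_of_mul_pos_left h (Real.exp_pos s).le

/-- The same integrating factor applied to the difference leaves `(x ^ (n + 2) + n x ^ (n + 1)) exp
x ≥ 0`. The resulting bound on `F n` serves twice: it keeps solutions away from `0` in finite time,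
and it makes `log φ` Lipschitz for the metric. -/
theorem sF_le (n : ℕ) {s : ℝ} (hs : 0 < s) : sF n s ≤ s ^ (n + 2) := by
  have hd : ∀ x, HasDerivAt (fun x => (x ^ (n + 2) - sF n x) * Real.exp x)
      ((x ^ (n + 2) + n * x ^ (n + 1)) * Real.exp x) x :=
    fun x => (((hasDerivAt_pow (n + 2) x).sub (hasDerivAt_sF n x)).mul
      (Real.hasDerivAt_exp x)).congr_deriv (by push_cast; simp; ring)
  have h := monotoneOn_of_deriv_nonneg (convex_Ici (0 : ℝ))
    (fun x _ => (hd x).continuousAt.continuousWithinAt)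
    (fun x _ => (hd x).differentiableAt.differentiableWithinAt)
    (fun x hx => by
      rw [interior_Ici] at hx
      rw [(hd x).deriv]
      have : (0 : ℝ) < x := hx
      positivity) Set.self_mem_Ici hs.le hs.le
  simp only [sF_zero, sub_zero] at h
  have := nonneg_of_mul_nonneg_left (by simpa using h) (Real.exp_pos s)
  linarith

theorem F_pos (n : ℕ) {s : ℝ} (hs : 0 < s) : 0 < F n s := by
  rw [F_eq_sF_div]; exact div_pos (sF_pos n hs) hs

theorem F_le (n : ℕ) {s : ℝ} (hs : 0 < s) : F n s ≤ s ^ (n + 1) := by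
  rw [F_eq_sF_div, div_le_iff₀ hs, ← pow_succ]; exact sF_le n hs

theorem contDiff_sF (n : ℕ) : ContDiff ℝ ∞ (sF n) := by
  unfold sF
  fun_prop

theorem contDiffOn_F (n : ℕ) : ContDiffOn ℝ ∞ (F n) (Set.Ioi 0) := by
  have : F n = fun s => sF n s / s := funext (F_eq_sF_div n)
  rw [this]
  exact (contDiff_sF n).contDiffOn.div contDiffOn_id fun x hx => ne_of_gt hx

/-- The derivative of `F_n` on the positive half line. -/
noncomputable def derivF (n : ℕ) (s : ℝ) : ℝ := 2 * s ^ n - F n s - F n s / s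

theorem hasDerivAt_F (n : ℕ) {s : ℝ} (hs : s ≠ 0) : HasDerivAt (F n) (derivF n s) s := by
  have : F n = fun s => sF n s / s := funext (F_eq_sF_div n)
  have h := (hasDerivAt_sF n s).div (hasDerivAt_id s) hs
  have e : F n = sF n / id := this
  rw [e]
  refine h.congr_deriv ?_
  rw [derivF, F_eq_sF_div]
  simp only [id]
  field_simp
  ring

theorem hasDerivAt_derivF (n : ℕ) {s : ℝ} (hs : s ≠ 0) : HasDerivAt (derivF n)
    (2 * (n * s ^ (n - 1)) - derivF n s - (derivF n s / s - F n s / s ^ 2)) s := by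
  have h := (((hasDerivAt_pow n s).const_mul 2).sub (hasDerivAt_F n hs)).sub
    ((hasDerivAt_F n hs).div (hasDerivAt_id s) hs)
  refine h.congr_deriv ?_
  simp only [id]
  field_simp

theorem continuousOn_F (n : ℕ) : ContinuousOn (F n) (Set.Ioi 0) := (contDiffOn_F n).continuousOn

end Heisenberg

/-! ### The initial value problem, by separation of variables. -/

namespace Heisenberg

open Set

/-- The time a solution of `φ' = F_n(φ)` needs to go from `φ₀` to `s`. -/
noncomputable def travelTime (n : ℕ) (φ₀ s : ℝ) : ℝ := ∫ x in φ₀..s, 1 / F n x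

theorem continuousOn_one_div_F (n : ℕ) : ContinuousOn (fun s => 1 / F n s) (Ioi 0) :=
  continuousOn_const.div (continuousOn_F n) fun _ hx => (F_pos n hx).ne'

theorem uIcc_subset_Ioi {a b : ℝ} (ha : 0 < a) (hb : 0 < b) : uIcc a b ⊆ Ioi 0 :=
  fun _ hx => (lt_min ha hb).trans_le hx.1

theorem intervalIntegrable_one_div_F (n : ℕ) {a b : ℝ} (ha : 0 < a) (hb : 0 < b) :
    IntervalIntegrable (fun s => 1 / F n s) MeasureTheory.volume a b :=
  ((continuousOn_one_div_F n).mono (uIcc_subset_Ioi ha hb)).intervalIntegrable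

theorem hasDerivAt_travelTime (n : ℕ) {φ₀ s : ℝ} (hφ₀ : 0 < φ₀) (hs : 0 < s) :
    HasDerivAt (travelTime n φ₀) (1 / F n s) s :=
  intervalIntegral.integral_hasDerivAt_right (intervalIntegrable_one_div_F n hφ₀ hs)
    ((continuousOn_one_div_F n).stronglyMeasurableAtFilter isOpen_Ioi s hs)
    ((continuousOn_one_div_F n).continuousAt (Ioi_mem_nhds hs))

theorem travelTime_self (n : ℕ) (φ₀ : ℝ) : travelTime n φ₀ φ₀ = 0 := intervalIntegral.integral_same

theorem continuousOn_travelTime (n : ℕ) {φ₀ : ℝ} (hφ₀ : 0 < φ₀) :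
    ContinuousOn (travelTime n φ₀) (Ioi 0) :=
  fun _ hs => (hasDerivAt_travelTime n hφ₀ hs).continuousAt.continuousWithinAt

theorem strictMonoOn_travelTime (n : ℕ) {φ₀ : ℝ} (hφ₀ : 0 < φ₀) :
    StrictMonoOn (travelTime n φ₀) (Ioi 0) := by
  refine strictMonoOn_of_deriv_pos (convex_Ioi 0) (continuousOn_travelTime n hφ₀) fun x hx => ?_
  rw [interior_Ioi] at hx
  rw [(hasDerivAt_travelTime n hφ₀ hx).deriv]
  exact one_div_pos.2 (F_pos n hx)

theorem lintegral_one_div_F (n : ℕ) {a b : ℝ} (ha : 0 < a) (hab : a ≤ b) :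
    ∫⁻ s in Ioo a b, ENNReal.ofReal (1 / F n s) = ENNReal.ofReal (travelTime n a b) := by
  rw [travelTime, intervalIntegral.integral_of_le hab, MeasureTheory.integral_Ioc_eq_integral_Ioo,
    MeasureTheory.ofReal_integral_eq_lintegral_ofReal]
  · exact ((intervalIntegrable_iff_integrableOn_Ioo_of_le hab).1
      (intervalIntegrable_one_div_F n ha (ha.trans_le hab)))
  · refine (MeasureTheory.ae_restrict_iff' measurableSet_Ioo).2 (Filter.Eventually.of_forall ?_)
    exact fun x hx => (one_div_pos.2 (F_pos n (ha.trans hx.1))).le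

theorem travelTime_symm (n : ℕ) (a b : ℝ) : travelTime n a b = -travelTime n b a :=
  intervalIntegral.integral_symm _ _

/-- The time needed to come from `0` to `φ₀`. -/
noncomputable def timeFromZero (n : ℕ) (φ₀ : ℝ) : ℝ≥0∞ :=
  ∫⁻ s in Ioo 0 φ₀, ENNReal.ofReal (1 / F n s)

/-- The time needed to go from `φ₀` to `∞`. -/
noncomputable def timeToInfinity (n : ℕ) (φ₀ : ℝ) : ℝ≥0∞ :=
  ∫⁻ s in Ioi φ₀, ENNReal.ofReal (1 / F n s)

/-- Exhausting by intervals bounded away from `0` replaces a possibly infinite integral by a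
supremum of values of `travelTime`. -/
theorem timeFromZero_eq_iSup (n : ℕ) {φ₀ : ℝ} (hφ₀ : 0 < φ₀) :
    timeFromZero n φ₀ = ⨆ k : ℕ, ENNReal.ofReal (-travelTime n φ₀ (φ₀ / (k + 1))) := by
  have hU : Ioo 0 φ₀ = ⋃ k : ℕ, Ioo (φ₀ / (k + 1)) φ₀ := by
    ext x
    simp only [mem_Ioo, mem_iUnion]
    refine ⟨fun ⟨h0, h1⟩ => ?_, fun ⟨k, h0, h1⟩ => ⟨lt_trans (by positivity) h0, h1⟩⟩
    obtain ⟨k, hk⟩ := exists_nat_gt (φ₀ / x)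
    refine ⟨k, ?_, h1⟩
    rw [div_lt_iff₀ h0] at hk
    rw [div_lt_iff₀ (by positivity)]
    nlinarith
  rw [timeFromZero, hU, MeasureTheory.setLIntegral_iUnion_of_directed]
  · refine iSup_congr fun k => ?_
    rw [lintegral_one_div_F n (by positivity) (div_le_self hφ₀.le (by simp)), travelTime_symm]
  · refine (Monotone.directed_le fun i j hij => ?_)
    refine Ioo_subset_Ioo_left (div_le_div_of_nonneg_left hφ₀.le (by positivity) ?_)
    exact_mod_cast Nat.succ_le_succ hij

theorem timeToInfinity_eq_iSup (n : ℕ) {φ₀ : ℝ} (hφ₀ : 0 < φ₀) :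
    timeToInfinity n φ₀ = ⨆ k : ℕ, ENNReal.ofReal (travelTime n φ₀ (φ₀ + k)) := by
  have hU : Ioi φ₀ = ⋃ k : ℕ, Ioo φ₀ (φ₀ + k) := by
    ext x
    simp only [mem_Ioi, mem_Ioo, mem_iUnion]
    refine ⟨fun h0 => ?_, fun ⟨k, h0, _⟩ => h0⟩
    obtain ⟨k, hk⟩ := exists_nat_gt (x - φ₀)
    exact ⟨k, h0, by linarith⟩
  rw [timeToInfinity, hU, MeasureTheory.setLIntegral_iUnion_of_directed]
  · exact iSup_congr fun k => lintegral_one_div_F n hφ₀ (by simp)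
  · refine (Monotone.directed_le fun i j hij => ?_)
    refine Ioo_subset_Ioo_right ?_
    have : (i : ℝ) ≤ j := by exact_mod_cast hij
    linarith

theorem ofReal_lt_timeFromZero_iff (n : ℕ) {φ₀ : ℝ} (hφ₀ : 0 < φ₀) (r : ℝ) :
    ENNReal.ofReal (-r) < timeFromZero n φ₀ ↔ ∃ s, 0 < s ∧ travelTime n φ₀ s < r := by
  rw [timeFromZero_eq_iSup n hφ₀, lt_iSup_iff]
  constructor
  · rintro ⟨k, hk⟩
    exact ⟨φ₀ / (k + 1), by positivity, neg_lt_neg_iff.1 (lt_of_not_ge fun h =>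
      hk.not_ge (ENNReal.ofReal_le_ofReal h))⟩
  · rintro ⟨s, hs, hsr⟩
    obtain ⟨k, hk⟩ := exists_nat_gt (φ₀ / s)
    have hm := strictMonoOn_travelTime n hφ₀
    rw [div_lt_iff₀ hs] at hk
    have hpos : 0 < φ₀ / ((k + 1 : ℕ) + 1) := by positivity
    -- The index `k + 1` makes the point strictly smaller than `φ₀`, so the elapsed time is positive
    -- and the truncation in `ENNReal.ofReal` is harmless.
    refine ⟨k + 1, (ENNReal.ofReal_lt_ofReal_iff ?_).2 (neg_lt_neg ?_)⟩
    · rw [neg_pos, ← travelTime_self n φ₀]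
      exact hm hpos hφ₀ (div_lt_self hφ₀ (by push_cast; linarith [k.cast_nonneg (α := ℝ)]))
    · refine lt_of_le_of_lt (hm.monotoneOn hpos hs ?_) hsr
      rw [div_le_iff₀ (by positivity)]
      push_cast
      nlinarith

theorem ofReal_lt_timeToInfinity_iff (n : ℕ) {φ₀ : ℝ} (hφ₀ : 0 < φ₀) (r : ℝ) :
    ENNReal.ofReal r < timeToInfinity n φ₀ ↔ ∃ s, 0 < s ∧ r < travelTime n φ₀ s := by
  rw [timeToInfinity_eq_iSup n hφ₀, lt_iSup_iff]
  constructor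
  · rintro ⟨k, hk⟩
    exact ⟨φ₀ + k, by positivity, lt_of_not_ge fun h => hk.not_ge (ENNReal.ofReal_le_ofReal h)⟩
  · rintro ⟨s, hs, hsr⟩
    obtain ⟨k, hk⟩ := exists_nat_gt (s - φ₀)
    have hm := strictMonoOn_travelTime n hφ₀
    have hpos : 0 < φ₀ + (k + 1 : ℕ) := by positivity
    refine ⟨k + 1, (ENNReal.ofReal_lt_ofReal_iff ?_).2 ?_⟩
    · rw [← travelTime_self n φ₀]
      exact hm hφ₀ hpos (by push_cast; linarith [k.cast_nonneg (α := ℝ)])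
    · exact lt_of_lt_of_le hsr (hm.monotoneOn hs hpos (by push_cast; linarith))

/-- For `q ≥ q₀` the truncated right side reads `0 < L`, which is why `L` has to be positive. -/
theorem coe_sub_lt_iff {L : ℝ≥0∞} (hL : 0 < L) (q₀ q : ℝ) :
    (q₀ : EReal) - (L : EReal) < q ↔ ENNReal.ofReal (q₀ - q) < L := by
  induction L using ENNReal.recTopCoe with
  | top => simp
  | coe r =>
    have hr : 0 < r := by simpa using hL
    have e : ((r : ℝ≥0∞) : EReal) = ((r : ℝ) : EReal) := rfl
    rw [e, ← EReal.coe_sub, EReal.coe_lt_coe_iff, ENNReal.ofReal, ENNReal.coe_lt_coe, ← NNReal.coe_lt_coe, Real.coe_toNNReal',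
      max_lt_iff, and_iff_left (NNReal.coe_pos.2 hr)]
    constructor <;> intro h <;> linarith

theorem lt_coe_add_iff {L : ℝ≥0∞} (hL : 0 < L) (q₀ q : ℝ) :
    (q : EReal) < (q₀ : EReal) + (L : EReal) ↔ ENNReal.ofReal (q - q₀) < L := by
  induction L using ENNReal.recTopCoe with
  | top => simp
  | coe r =>
    have hr : 0 < r := by simpa using hL
    have e : ((r : ℝ≥0∞) : EReal) = ((r : ℝ) : EReal) := rfl
    rw [e, ← EReal.coe_add, EReal.coe_lt_coe_iff, ENNReal.ofReal, ENNReal.coe_lt_coe, ← NNReal.coe_lt_coe, Real.coe_toNNReal',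
      max_lt_iff, and_iff_left (NNReal.coe_pos.2 hr)]
    constructor <;> intro h <;> linarith

/-- The interval `(q_a, q_b)` is the set of times at which the implicit equation for the solution
can be solved. -/
theorem mem_interval_iff (n : ℕ) (q₀ : ℝ) {φ₀ : ℝ} (hφ₀ : 0 < φ₀) (q : ℝ) :
    q ∈ interval n q₀ φ₀ ↔ ∃ s, 0 < s ∧ travelTime n φ₀ s = q - q₀ := by
  have hm := strictMonoOn_travelTime n hφ₀
  have h0 := travelTime_self n φ₀
  have hL : 0 < timeFromZero n φ₀ := by
    have := (ofReal_lt_timeFromZero_iff n hφ₀ 0).2 ⟨φ₀ / 2, by positivity, by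
      rw [← h0]; exact hm (by simpa using hφ₀) hφ₀ (by linarith)⟩
    simpa using this
  have hR : 0 < timeToInfinity n φ₀ := by
    have := (ofReal_lt_timeToInfinity_iff n hφ₀ 0).2 ⟨φ₀ + 1, by positivity, by
      rw [← h0]; exact hm hφ₀ (by simp; positivity) (by linarith)⟩
    simpa using this
  have hmem : q ∈ interval n q₀ φ₀ ↔ (∃ s, 0 < s ∧ travelTime n φ₀ s < q - q₀) ∧
      ∃ s, 0 < s ∧ q - q₀ < travelTime n φ₀ s := by
    rw [← ofReal_lt_timeFromZero_iff n hφ₀, ← ofReal_lt_timeToInfinity_iff n hφ₀, neg_sub,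
      ← coe_sub_lt_iff hL, ← lt_coe_add_iff hR]
    rfl
  rw [hmem]
  constructor
  · rintro ⟨⟨s, hs, hs'⟩, t, ht, ht'⟩
    -- The two end conditions place `q - q₀` strictly between two values of `travelTime`, so it is
    -- itself a value.
    obtain ⟨x, hx, hx'⟩ := isPreconnected_Ioi.intermediate_value (mem_Ioi.2 hs) (mem_Ioi.2 ht)
      (continuousOn_travelTime n hφ₀) ⟨hs'.le, ht'.le⟩
    exact ⟨x, hx, hx'⟩
  · rintro ⟨s, hs, hs'⟩
    rw [← hs']
    have : (0 : ℝ) < s + 1 := by positivity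
    exact ⟨⟨s / 2, by positivity, hm (by simpa using hs) hs (by linarith)⟩,
      ⟨s + 1, by positivity, hm hs this (by linarith)⟩⟩

theorem isOpen_interval (n : ℕ) (q₀ φ₀ : ℝ) : IsOpen (interval n q₀ φ₀) :=
  (isOpen_lt continuous_const continuous_coe_real_ereal).inter
    (isOpen_lt continuous_coe_real_ereal continuous_const)

theorem ordConnected_interval (n : ℕ) (q₀ φ₀ : ℝ) : (interval n q₀ φ₀).OrdConnected :=
  ⟨fun _ hx _ hy _ hz => ⟨hx.1.trans_le (EReal.coe_le_coe_iff.2 hz.1),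
    (EReal.coe_le_coe_iff.2 hz.2).trans_lt hy.2⟩⟩

theorem self_mem_interval (n : ℕ) (q₀ : ℝ) {φ₀ : ℝ} (hφ₀ : 0 < φ₀) : q₀ ∈ interval n q₀ φ₀ :=
  (mem_interval_iff n q₀ hφ₀ q₀).2 ⟨φ₀, hφ₀, by rw [travelTime_self, sub_self]⟩

/-- A solution is bounded below by a positive constant times an exponential as long as it stays
positive, so that it stays positive forever. -/
theorem IsSolution.pos {n : ℕ} {q₀ φ₀ : ℝ} (hφ₀ : 0 < φ₀) {I : Set ℝ} {ψ : ℝ → ℝ}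
    (hI : I.OrdConnected) (hq₀ : q₀ ∈ I) (h : IsSolution n q₀ φ₀ I ψ) {q : ℝ} (hq : q ∈ I) :
    0 < ψ q := by
  by_contra hneg
  push Not at hneg
  obtain ⟨h0, hd⟩ := h
  have hψ0 : 0 < ψ q₀ := h0 ▸ hφ₀
  have hcont : ∀ a b, a ∈ I → b ∈ I → ContinuousOn ψ (Icc a b) := fun a b ha hb x hx =>
    (hd x (hI.out ha hb hx)).continuousAt.continuousWithinAt
  rcases le_total q q₀ with hle | hle
  · -- the last time before `q₀` at which `ψ ≤ 0`
    have hcl : IsCompact (Icc q q₀ ∩ ψ ⁻¹' Iic 0) :=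
      isCompact_Icc.of_isClosed_subset
        ((hcont q q₀ hq hq₀).preimage_isClosed_of_isClosed isClosed_Icc isClosed_Iic)
        inter_subset_left
    obtain ⟨r, hr, hmax⟩ := hcl.exists_isGreatest ⟨q, ⟨left_mem_Icc.2 hle, hneg⟩⟩
    have hrI : r ∈ I := hI.out hq hq₀ hr.1
    have hpos : ∀ x, r < x → x ≤ q₀ → 0 < ψ x := fun x hx hx' => by
      by_contra hc
      exact hx.not_ge (hmax ⟨⟨hr.1.1.trans hx.le, hx'⟩, not_lt.1 hc⟩)
    have hrlt : r < q₀ := lt_of_le_of_ne hr.1.2 fun e => by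
      have := hr.2
      rw [e] at this
      exact absurd hψ0 (not_lt.2 this)
    have hmono : MonotoneOn ψ (Icc r q₀) := by
      refine monotoneOn_of_deriv_nonneg (convex_Icc _ _) (hcont r q₀ hrI hq₀)
        (fun x hx => ?_) fun x hx => ?_
      · exact (hd x (hI.out hrI hq₀ (interior_subset hx))).differentiableAt.differentiableWithinAt
      · rw [(hd x (hI.out hrI hq₀ (interior_subset hx))).deriv]
        rw [interior_Icc] at hx
        exact (F_pos n (hpos x hx.1 hx.2.le)).le
    -- On `(r, q₀)` one has `0 < ψ ≤ φ₀`, so `F n (ψ) ≤ ψ ^ (n + 1) ≤ φ₀ ^ n * ψ`. Hence `ψ` decays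
    -- backwards in time at most exponentially, at rate `φ₀ ^ n`, and cannot reach `0` at `r`.
    have hexp : MonotoneOn (fun x => -(ψ x * Real.exp (-(φ₀ ^ n * x)))) (Icc r q₀) := by
      have hder : ∀ x ∈ I, HasDerivAt (fun x => -(ψ x * Real.exp (-(φ₀ ^ n * x))))
          ((φ₀ ^ n * ψ x - F n (ψ x)) * Real.exp (-(φ₀ ^ n * x))) x := fun x hx =>
        ((hd x hx).mul ((hasDerivAt_id x).const_mul (φ₀ ^ n)).neg.exp).neg.congr_deriv (by
          simp; ring)
      refine monotoneOn_of_deriv_nonneg (convex_Icc _ _)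
        (fun x hx => (hder x (hI.out hrI hq₀ hx)).continuousAt.continuousWithinAt)
        (fun x hx => (hder x (hI.out hrI hq₀
          (interior_subset hx))).differentiableAt.differentiableWithinAt) fun x hx => ?_
      rw [(hder x (hI.out hrI hq₀ (interior_subset hx))).deriv]
      rw [interior_Icc] at hx
      have hx0 := hpos x hx.1 hx.2.le
      have h1 : ψ x ≤ φ₀ := h0 ▸ hmono ⟨hx.1.le, hx.2.le⟩ (right_mem_Icc.2 hrlt.le) hx.2.le
      have h2 : F n (ψ x) ≤ φ₀ ^ n * ψ x := (F_le n hx0).trans (by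
        rw [pow_succ]; gcongr)
      exact mul_nonneg (sub_nonneg.2 h2) (Real.exp_pos _).le
    have h3 := hexp (left_mem_Icc.2 hrlt.le) (right_mem_Icc.2 hrlt.le) hrlt.le
    simp only [neg_le_neg_iff] at h3
    have h4 : 0 < ψ q₀ * Real.exp (-(φ₀ ^ n * q₀)) := by positivity
    have h5 : ψ r * Real.exp (-(φ₀ ^ n * r)) ≤ 0 :=
      mul_nonpos_of_nonpos_of_nonneg hr.2 (Real.exp_pos _).le
    linarith
  · -- the first time after `q₀` at which `ψ ≤ 0`
    have hcl : IsCompact (Icc q₀ q ∩ ψ ⁻¹' Iic 0) :=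
      isCompact_Icc.of_isClosed_subset
        ((hcont q₀ q hq₀ hq).preimage_isClosed_of_isClosed isClosed_Icc isClosed_Iic)
        inter_subset_left
    obtain ⟨r, hr, hmin⟩ := hcl.exists_isLeast ⟨q, ⟨right_mem_Icc.2 hle, hneg⟩⟩
    have hrI : r ∈ I := hI.out hq₀ hq hr.1
    have hmono : MonotoneOn ψ (Icc q₀ r) := by
      refine monotoneOn_of_deriv_nonneg (convex_Icc _ _) (hcont q₀ r hq₀ hrI)
        (fun x hx => ?_) fun x hx => ?_
      · exact (hd x (hI.out hq₀ hrI (interior_subset hx))).differentiableAt.differentiableWithinAt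
      · rw [(hd x (hI.out hq₀ hrI (interior_subset hx))).deriv]
        rw [interior_Icc] at hx
        refine (F_pos n (lt_of_not_ge fun hc => hx.2.not_ge (hmin ⟨⟨hx.1.le, ?_⟩, hc⟩))).le
        exact hx.2.le.trans hr.1.2
    have h3 := hmono (left_mem_Icc.2 hr.1.1) (right_mem_Icc.2 hr.1.1) hr.1.1
    exact absurd (hψ0.trans_le h3) (not_lt.2 hr.2)

/-- By the chain rule `travelTime n φ₀ ∘ ψ` has derivative `1` on the interval, and it vanishes at
`q₀`. This implicit equation determines a solution completely. -/
theorem IsSolution.travelTime_eq {n : ℕ} {q₀ φ₀ : ℝ} (hφ₀ : 0 < φ₀) {I : Set ℝ} {ψ : ℝ → ℝ}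
    (hI : I.OrdConnected) (hIo : IsOpen I) (hq₀ : q₀ ∈ I) (h : IsSolution n q₀ φ₀ I ψ) {q : ℝ}
    (hq : q ∈ I) : travelTime n φ₀ (ψ q) = q - q₀ := by
  have hder : ∀ x ∈ I, HasDerivAt (fun x => travelTime n φ₀ (ψ x)) 1 x := fun x hx => by
    have hx0 := h.pos hφ₀ hI hq₀ hx
    refine ((hasDerivAt_travelTime n hφ₀ hx0).comp x (h.2 x hx)).congr_deriv ?_
    exact one_div_mul_cancel (F_pos n hx0).ne'
  have hder' : ∀ x, HasDerivAt (fun x => x - q₀) 1 x := fun x => (hasDerivAt_id x).sub_const q₀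
  refine hIo.eqOn_of_deriv_eq hI.isPreconnected
    (fun x hx => (hder x hx).differentiableAt.differentiableWithinAt)
    (fun x _ => (hder' x).differentiableAt.differentiableWithinAt)
    (fun x hx => by rw [(hder x hx).deriv, (hder' x).deriv]) hq₀ ?_ hq
  simp [h.1, travelTime_self]

/-- The solution is the inverse of `q₀ + travelTime`. It is monotone with image containing all of
`(0, ∞)`, hence continuous, and the derivative of an inverse function gives the equation. -/
theorem exists_isSolution (n : ℕ) (q₀ : ℝ) {φ₀ : ℝ} (hφ₀ : 0 < φ₀) :
    ∃ φ : ℝ → ℝ, IsSolution n q₀ φ₀ (interval n q₀ φ₀) φ := by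
  have hm := strictMonoOn_travelTime n hφ₀
  choose! φ hφpos hφ using fun q => (mem_interval_iff n q₀ hφ₀ q).1
  have hsurj : Ioi 0 ⊆ φ '' interval n q₀ φ₀ := fun s hs => by
    have hmem : q₀ + travelTime n φ₀ s ∈ interval n q₀ φ₀ :=
      (mem_interval_iff n q₀ hφ₀ _).2 ⟨s, hs, by ring⟩
    refine ⟨_, hmem, hm.injOn (hφpos _ hmem) hs ?_⟩
    rw [hφ _ hmem]; ring
  have hmono : MonotoneOn φ (interval n q₀ φ₀) := fun x hx y hy hxy => by
    rw [← hm.le_iff_le (hφpos x hx) (hφpos y hy), hφ x hx, hφ y hy]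
    linarith
  refine ⟨φ, ?_, fun q hq => ?_⟩
  · have h0 := self_mem_interval n q₀ hφ₀
    refine hm.injOn (hφpos _ h0) hφ₀ ?_
    rw [hφ _ h0, travelTime_self, sub_self]
  · have hnhds := (isOpen_interval n q₀ φ₀).mem_nhds hq
    have hcont : ContinuousAt φ q := continuousAt_of_monotoneOn_of_image_mem_nhds hmono hnhds
      (Filter.mem_of_superset (Ioi_mem_nhds (hφpos q hq)) hsurj)
    have hder := HasDerivAt.of_local_left_inverse (f := fun s => q₀ + travelTime n φ₀ s) hcont
      ((hasDerivAt_travelTime n hφ₀ (hφpos q hq)).const_add q₀)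
      (one_div_pos.2 (F_pos n (hφpos q hq))).ne'
      (by filter_upwards [hnhds] with y hy; rw [hφ y hy]; ring)
    simpa using hder

theorem IsSolution.maximal {n : ℕ} {q₀ φ₀ : ℝ} (hφ₀ : 0 < φ₀) {φ : ℝ → ℝ}
    (h : IsSolution n q₀ φ₀ (interval n q₀ φ₀) φ) {I : Set ℝ} {ψ : ℝ → ℝ} (hIo : IsOpen I)
    (hI : I.OrdConnected) (hq₀ : q₀ ∈ I) (hψ : IsSolution n q₀ φ₀ I ψ) :
    I ⊆ interval n q₀ φ₀ ∧ EqOn ψ φ I := by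
  have hsub : I ⊆ interval n q₀ φ₀ := fun q hq => (mem_interval_iff n q₀ hφ₀ q).2
    ⟨ψ q, hψ.pos hφ₀ hI hq₀ hq, hψ.travelTime_eq hφ₀ hI hIo hq₀ hq⟩
  have hJ := ordConnected_interval n q₀ φ₀
  have h0 := self_mem_interval n q₀ hφ₀
  refine ⟨hsub, fun q hq => (strictMonoOn_travelTime n hφ₀).injOn (hψ.pos hφ₀ hI hq₀ hq)
    (h.pos hφ₀ hJ h0 (hsub hq)) ?_⟩
  rw [hψ.travelTime_eq hφ₀ hI hIo hq₀ hq,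
    h.travelTime_eq hφ₀ hJ (isOpen_interval n q₀ φ₀) h0 (hsub hq)]

theorem IsSolution.pos_of_mem {n : ℕ} {q₀ φ₀ : ℝ} (hφ₀ : 0 < φ₀) {φ : ℝ → ℝ}
    (h : IsSolution n q₀ φ₀ (interval n q₀ φ₀) φ) {q : ℝ} (hq : q ∈ interval n q₀ φ₀) : 0 < φ q :=
  h.pos hφ₀ (ordConnected_interval n q₀ φ₀) (self_mem_interval n q₀ hφ₀) hq

theorem IsSolution.eq_add_travelTime {n : ℕ} {q₀ φ₀ : ℝ} (hφ₀ : 0 < φ₀) {φ : ℝ → ℝ}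
    (h : IsSolution n q₀ φ₀ (interval n q₀ φ₀) φ) {q : ℝ} (hq : q ∈ interval n q₀ φ₀) :
    q = q₀ + travelTime n φ₀ (φ q) := by
  rw [h.travelTime_eq hφ₀ (ordConnected_interval n q₀ φ₀) (isOpen_interval n q₀ φ₀)
    (self_mem_interval n q₀ hφ₀) hq]
  ring

theorem IsSolution.bijOn {n : ℕ} {q₀ φ₀ : ℝ} (hφ₀ : 0 < φ₀) {φ : ℝ → ℝ}
    (h : IsSolution n q₀ φ₀ (interval n q₀ φ₀) φ) : BijOn φ (interval n q₀ φ₀) (Ioi 0) := by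
  refine ⟨fun q hq => h.pos_of_mem hφ₀ hq, fun q hq r hr e => ?_, fun s hs => ?_⟩
  · rw [h.eq_add_travelTime hφ₀ hq, h.eq_add_travelTime hφ₀ hr, e]
  · have hmem : q₀ + travelTime n φ₀ s ∈ interval n q₀ φ₀ :=
      (mem_interval_iff n q₀ hφ₀ _).2 ⟨s, hs, by ring⟩
    refine ⟨_, hmem, (strictMonoOn_travelTime n hφ₀).injOn (h.pos_of_mem hφ₀ hmem) hs ?_⟩
    have := h.eq_add_travelTime hφ₀ hmem
    linarith

/-- Bootstrap: `φ' = F n (φ)` is as regular as `φ`, so each step gains one derivative. -/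
theorem IsSolution.contDiffOn {n : ℕ} {q₀ φ₀ : ℝ} (hφ₀ : 0 < φ₀) {φ : ℝ → ℝ}
    (h : IsSolution n q₀ φ₀ (interval n q₀ φ₀) φ) : ContDiffOn ℝ ∞ φ (interval n q₀ φ₀) := by
  have hmaps : MapsTo φ (interval n q₀ φ₀) (Ioi 0) := fun q hq => h.pos_of_mem hφ₀ hq
  have hdiff : DifferentiableOn ℝ φ (interval n q₀ φ₀) :=
    fun q hq => (h.2 q hq).differentiableAt.differentiableWithinAt
  refine contDiffOn_infty.2 fun k => ?_
  induction k with
  | zero => exact contDiffOn_zero.2 hdiff.continuousOn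
  | succ k ih =>
    push_cast
    refine (contDiffOn_succ_iff_deriv_of_isOpen (isOpen_interval n q₀ φ₀)).2
      ⟨hdiff, by simp, ?_⟩
    exact (((contDiffOn_F n).of_le (by exact_mod_cast le_top)).comp ih hmaps).congr
      fun q hq => (h.2 q hq).deriv

end Heisenberg

/-! ### Frame calculus: the metric isomorphism, components, traces, derivatives along lines. -/

namespace ChartGeometry

section

variable {V W : Type*} [NormedAddCommGroup V] [NormedSpace ℝ V]
  [NormedAddCommGroup W] [NormedSpace ℝ W]

/-- Once differentiability is known from smoothness, every derivative of a tensor field reduces to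
one-variable calculus along `p + t • u`, where `zeta`, `rot` and `hor` are affine in `t`. -/
theorem fderiv_eq_of_hasLineDerivAt {f : V → W} {p u : V} {f' : W} (hf : DifferentiableAt ℝ f p)
    (h : HasLineDerivAt ℝ f f' p u) : fderiv ℝ f p u = f' := by
  rw [← hf.lineDeriv_eq_fderiv, h.lineDeriv]

/-- The musical isomorphism of a positive definite form inverts it. -/
theorem inverse_apply_of_pos [FiniteDimensional ℝ V] (b : V →L[ℝ] V →L[ℝ] ℝ)
    (hb : ∀ v, v ≠ 0 → 0 < b v v) (w : V) : b.inverse (b w) = w := by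
  have hinj : Function.Injective b := (injective_iff_map_eq_zero b).2 fun v hv => by
    by_contra hne
    simpa [hv] using hb v hne
  have hrank : Module.finrank ℝ V = Module.finrank ℝ (V →L[ℝ] ℝ) := by
    rw [← (LinearMap.toContinuousLinearMap (𝕜 := ℝ) (E := V) (F' := ℝ)).finrank_eq]
    exact (Subspace.dual_finrank_eq (K := ℝ) (V := V)).symm
  let e : V ≃L[ℝ] (V →L[ℝ] ℝ) :=
    (LinearEquiv.ofBijective (b : V →ₗ[ℝ] V →L[ℝ] ℝ)
      ⟨hinj, (LinearMap.injective_iff_surjective_of_finrank_eq_finrank hrank).1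
        hinj⟩).toContinuousLinearEquiv
  have he : b = (e : V →L[ℝ] V →L[ℝ] ℝ) := by ext; rfl
  rw [he, ContinuousLinearMap.inverse_equiv]
  exact e.symm_apply_apply w

end

end ChartGeometry

namespace Heisenberg

noncomputable section

open ChartGeometry

variable {n : ℕ}

/-- The bilinear form `∑ σᵢ ⊗ σᵢ`. -/
def xx : Amb n →L[ℝ] Amb n →L[ℝ] ℝ := ∑ i, (sigma i).smulRight (sigma i)

/-- The bilinear form `∑ ρᵢ ⊗ ρᵢ`. -/
def yy : Amb n →L[ℝ] Amb n →L[ℝ] ℝ := ∑ i, (rho i).smulRight (rho i)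

/-- The bilinear form `∑ σᵢ ⊗ ρᵢ`; `dζ` is its antisymmetrization. -/
def xy : Amb n →L[ℝ] Amb n →L[ℝ] ℝ := ∑ i, (sigma i).smulRight (rho i)

/-- The rotation `Xᵢ ↦ Yᵢ`, `Yᵢ ↦ -Xᵢ`, `Z ↦ 0`, `∂_q ↦ 0`. -/
def rot (p : Amb n) : Amb n →L[ℝ] Amb n :=
  ∑ i : Fin n, ((sigma i).smulRight (vecY i p) - (rho i).smulRight (vecX i))

/-- The projection to the span of the `Xᵢ` and `Yᵢ`. -/
def hor (p : Amb n) : Amb n →L[ℝ] Amb n :=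
  ContinuousLinearMap.id ℝ (Amb n) - (zeta p).smulRight (vecZ n) - (dq n).smulRight (vecQ n)

theorem xx_apply (u v : Amb n) : xx u v = ∑ i, sigma i u * sigma i v := by
  simp [xx]

theorem yy_apply (u v : Amb n) : yy u v = ∑ i, rho i u * rho i v := by
  simp [yy]

theorem xy_apply (u v : Amb n) : xy u v = ∑ i, sigma i u * rho i v := by
  simp [xy]

theorem rot_apply (p u : Amb n) :
    rot p u = ∑ i : Fin n, (sigma i u • vecY i p - rho i u • vecX i) := by
  simp [rot]

theorem hor_apply (p u : Amb n) : hor p u = u - zeta p u • vecZ n - dq n u • vecQ n := by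
  simp [hor]

theorem xx_comm (u v : Amb n) : xx u v = xx v u := by simp only [xx_apply, mul_comm]

theorem yy_comm (u v : Amb n) : yy u v = yy v u := by simp only [yy_apply, mul_comm]

section frame

variable (i j : Fin n) (p u v : Amb n)

@[simp] theorem sigma_vecX : sigma i (vecX j : Amb n) = if i = j then 1 else 0 :=
  (frame_dual 0 i j).1
@[simp] theorem sigma_vecY : sigma i (vecY j p) = 0 := rfl
@[simp] theorem sigma_vecZ : sigma i (vecZ n) = 0 := rfl
@[simp] theorem sigma_vecQ : sigma i (vecQ n) = 0 := rfl
@[simp] theorem rho_vecX : rho i (vecX j : Amb n) = 0 := rfl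
@[simp] theorem rho_vecY : rho i (vecY j p) = if i = j then 1 else 0 :=
  (frame_dual p i j).2.2.2.2.2.1
@[simp] theorem rho_vecZ : rho i (vecZ n) = 0 := rfl
@[simp] theorem rho_vecQ : rho i (vecQ n) = 0 := rfl
@[simp] theorem zeta_vecX : zeta p (vecX j) = 0 := (frame_dual p j j).2.2.2.2.2.2.2.2.1
@[simp] theorem zeta_vecY : zeta p (vecY j p) = 0 := (frame_dual p j j).2.2.2.2.2.2.2.2.2.1
@[simp] theorem zeta_vecZ : zeta p (vecZ n) = 1 := by
  have h : dz n (vecZ n) = -1 := rfl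
  simp [zeta, h]
@[simp] theorem zeta_vecQ : zeta p (vecQ n) = 0 := by
  have h : dz n (vecQ n) = 0 := rfl
  simp [zeta, h]
@[simp] theorem dq_vecX : dq n (vecX j) = 0 := rfl
@[simp] theorem dq_vecY : dq n (vecY j p) = 0 := rfl
@[simp] theorem dq_vecZ : dq n (vecZ n) = 0 := rfl
@[simp] theorem dq_vecQ : dq n (vecQ n) = 1 := rfl

@[simp] theorem xx_vecX_left : xx (vecX i) v = sigma i v := by simp [xx_apply]
@[simp] theorem xx_vecX_right : xx v (vecX i) = sigma i v := by simp [xx_apply]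
@[simp] theorem xx_vecY_left : xx (vecY i p) v = 0 := by simp [xx_apply]
@[simp] theorem xx_vecY_right : xx v (vecY i p) = 0 := by simp [xx_apply]
@[simp] theorem xx_vecZ_left : xx (vecZ n) v = 0 := by simp [xx_apply]
@[simp] theorem xx_vecZ_right : xx v (vecZ n) = 0 := by simp [xx_apply]
@[simp] theorem xx_vecQ_left : xx (vecQ n) v = 0 := by simp [xx_apply]
@[simp] theorem xx_vecQ_right : xx v (vecQ n) = 0 := by simp [xx_apply]
@[simp] theorem yy_vecX_left : yy (vecX i) v = 0 := by simp [yy_apply]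
@[simp] theorem yy_vecX_right : yy v (vecX i) = 0 := by simp [yy_apply]
@[simp] theorem yy_vecY_left : yy (vecY i p) v = rho i v := by simp [yy_apply]
@[simp] theorem yy_vecY_right : yy v (vecY i p) = rho i v := by simp [yy_apply]
@[simp] theorem yy_vecZ_left : yy (vecZ n) v = 0 := by simp [yy_apply]
@[simp] theorem yy_vecZ_right : yy v (vecZ n) = 0 := by simp [yy_apply]
@[simp] theorem yy_vecQ_left : yy (vecQ n) v = 0 := by simp [yy_apply]
@[simp] theorem yy_vecQ_right : yy v (vecQ n) = 0 := by simp [yy_apply]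
@[simp] theorem xy_vecX_left : xy (vecX i) v = rho i v := by simp [xy_apply]
@[simp] theorem xy_vecX_right : xy v (vecX i) = 0 := by simp [xy_apply]
@[simp] theorem xy_vecY_left : xy (vecY i p) v = 0 := by simp [xy_apply]
@[simp] theorem xy_vecY_right : xy v (vecY i p) = sigma i v := by simp [xy_apply]
@[simp] theorem xy_vecZ_left : xy (vecZ n) v = 0 := by simp [xy_apply]
@[simp] theorem xy_vecZ_right : xy v (vecZ n) = 0 := by simp [xy_apply]
@[simp] theorem xy_vecQ_left : xy (vecQ n) v = 0 := by simp [xy_apply]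
@[simp] theorem xy_vecQ_right : xy v (vecQ n) = 0 := by simp [xy_apply]

@[simp] theorem sigma_rot : sigma i (rot p u) = -rho i u := by
  simp [rot_apply]
@[simp] theorem rho_rot : rho i (rot p u) = sigma i u := by simp [rot_apply]
@[simp] theorem zeta_rot : zeta p (rot p u) = 0 := by simp [rot_apply]
@[simp] theorem dq_rot : dq n (rot p u) = 0 := by simp [rot_apply]
@[simp] theorem rot_vecX : rot p (vecX i) = vecY i p := by
  simp [rot_apply, sigma_vecX, ite_smul]
@[simp] theorem rot_vecY : rot p (vecY i p) = -vecX i := by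
  simp [rot_apply, ite_smul]
@[simp] theorem rot_vecZ : rot p (vecZ n) = 0 := by simp [rot_apply]
@[simp] theorem rot_vecQ : rot p (vecQ n) = 0 := by simp [rot_apply]
@[simp] theorem xx_rot_left : xx (rot p u) v = -xy v u := by
  simp [xx_apply, xy_apply, mul_comm]
@[simp] theorem xx_rot_right : xx u (rot p v) = -xy u v := by simp [xx_apply, xy_apply]
@[simp] theorem yy_rot_left : yy (rot p u) v = xy u v := by simp [yy_apply, xy_apply]
@[simp] theorem yy_rot_right : yy u (rot p v) = xy v u := by
  simp [yy_apply, xy_apply, mul_comm]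
@[simp] theorem xy_rot_left : xy (rot p u) v = -yy u v := by simp [yy_apply, xy_apply]
@[simp] theorem xy_rot_right : xy u (rot p v) = xx u v := by simp [xx_apply, xy_apply]

theorem ext_of_coord {u v : Amb n} (hx : ∀ i, sigma i u = sigma i v) (hy : ∀ i, rho i u = rho i v)
    (hz : dz n u = dz n v) (hq : dq n u = dq n v) : u = v :=
  Prod.ext (Prod.ext (funext hx) (Prod.ext (funext hy) hz)) hq

/-- Expansion of a vector in the frame. -/
theorem frame_expansion : u = (∑ i, sigma i u • vecX i) + (∑ i, rho i u • vecY i p)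
    + zeta p u • vecZ n + dq n u • vecQ n := by
  have hz : dz n u = ∑ i, sigma i p * rho i u - zeta p u := by simp [zeta]
  refine ext_of_coord (fun k => by simp) (fun k => by simp) ?_ (by simp)
  have hX : ∀ i, dz n (vecX i) = 0 := fun _ => rfl
  have hY : ∀ i, dz n (vecY i p) = sigma i p := fun _ => rfl
  have hZ : dz n (vecZ n) = -1 := rfl
  have hQ : dz n (vecQ n) = 0 := rfl
  simp [hX, hY, hZ, hQ, hz, mul_comm, sub_eq_add_neg]

theorem hor_eq_sum : hor p u = (∑ i, sigma i u • vecX i) + ∑ i, rho i u • vecY i p := by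
  rw [hor_apply]
  nth_rewrite 1 [frame_expansion p u]
  abel

theorem rot_rot : rot p (rot p u) = -hor p u := by
  rw [hor_eq_sum, rot_apply]
  simp only [sigma_rot, rho_rot, neg_smul, Finset.sum_sub_distrib, Finset.sum_neg_distrib]
  abel

/-- The trace of an endomorphism in the frame. -/
theorem trace_eq_sum (T : Amb n →L[ℝ] Amb n) :
    LinearMap.trace ℝ (Amb n) (T : Amb n →ₗ[ℝ] Amb n) =
      (∑ i, (sigma i (T (vecX i)) + rho i (T (vecY i p)))) + zeta p (T (vecZ n))
        + dq n (T (vecQ n)) := by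
  have hT : (T : Amb n →ₗ[ℝ] Amb n) =
      (∑ i, ((sigma i : Amb n →ₗ[ℝ] ℝ).smulRight (T (vecX i))
        + (rho i : Amb n →ₗ[ℝ] ℝ).smulRight (T (vecY i p))))
      + (zeta p : Amb n →ₗ[ℝ] ℝ).smulRight (T (vecZ n))
      + (dq n : Amb n →ₗ[ℝ] ℝ).smulRight (T (vecQ n)) := by
    refine LinearMap.ext fun u => ?_
    conv_lhs => rw [frame_expansion p u]
    simp [Finset.sum_add_distrib]
  rw [hT]
  simp only [map_add, map_sum, LinearMap.trace_smulRight]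
  rfl

end frame

/-! ### Derivatives along lines -/

theorem zeta_add_smul (p u v : Amb n) (t : ℝ) :
    zeta (p + t • u) v = zeta p v + t * xy u v := by
  simp [zeta, xy_apply, add_mul, Finset.sum_add_distrib, Finset.mul_sum, mul_assoc]
  ring

theorem rot_add_smul (p u v : Amb n) (t : ℝ) :
    rot (p + t • u) v = rot p v - (t * xx v u) • vecZ n := by
  -- Only the coefficient `xᵢ` of `∂_z = -Z` in `Yᵢ` moves with the base point.
  have hY : ∀ i, vecY i (p + t • u) = vecY i p - (t * sigma i u) • vecZ n := fun i => by
    refine Prod.ext (Prod.ext ?_ (Prod.ext ?_ ?_)) ?_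
    · change (0 : Fin n → ℝ) = 0 - (t * sigma i u) • (0 : Fin n → ℝ)
      simp
    · change (Pi.single i 1 : Fin n → ℝ) = Pi.single i 1 - (t * sigma i u) • (0 : Fin n → ℝ)
      simp
    · change sigma i (p + t • u) = sigma i p - (t * sigma i u) * (-1)
      simp
    · change (0 : ℝ) = 0 - (t * sigma i u) * 0
      simp
  simp only [rot_apply, hY, xx_apply, Finset.mul_sum, Finset.sum_smul, smul_sub,
    ← Finset.sum_sub_distrib, smul_smul]
  refine Finset.sum_congr rfl fun i _ => ?_
  rw [mul_left_comm]
  abel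

theorem hasLineDerivAt_zeta (p u v : Amb n) :
    HasLineDerivAt ℝ (fun y => zeta y v) (xy u v) p u := by
  change HasDerivAt (fun t : ℝ => zeta (p + t • u) v) (xy u v) 0
  simp only [zeta_add_smul]
  simpa using ((hasDerivAt_id (0 : ℝ)).mul_const (xy u v)).const_add (zeta p v)

theorem hasLineDerivAt_rot (p u v : Amb n) :
    HasLineDerivAt ℝ (fun y => rot y v) (-(xx v u) • vecZ n) p u := by
  change HasDerivAt (fun t : ℝ => rot (p + t • u) v) (-(xx v u) • vecZ n) 0
  simp only [rot_add_smul]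
  have h := (((hasDerivAt_id (0 : ℝ)).mul_const (xx v u)).smul_const (vecZ n)).const_sub (rot p v)
  simpa using h

theorem hasLineDerivAt_hor (p u v : Amb n) :
    HasLineDerivAt ℝ (fun y => hor y v) (-(xy u v) • vecZ n) p u := by
  simp only [hor_apply]
  have h : HasDerivAt (fun t : ℝ => v - zeta (p + t • u) v • vecZ n - dq n v • vecQ n) _ 0 :=
    ((HasDerivAt.smul_const (hasLineDerivAt_zeta p u v) (vecZ n)).const_sub v).sub_const
      (dq n v • vecQ n)
  exact h.congr_deriv (by simp)

theorem hasLineDerivAt_comp_snd {f : ℝ → ℝ} {f' : ℝ} {p : Amb n} (h : HasDerivAt f f' p.2)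
    (u : Amb n) : HasLineDerivAt ℝ (fun y : Amb n => f y.2) (f' * dq n u) p u := by
  change HasDerivAt (fun t : ℝ => f (p.2 + t * u.2)) (f' * u.2) 0
  have h1 : HasDerivAt (fun t : ℝ => p.2 + t * u.2) u.2 0 := by
    simpa using ((hasDerivAt_id (0 : ℝ)).mul_const u.2).const_add p.2
  exact HasDerivAt.comp (0 : ℝ) (by simpa using h) h1

theorem contDiff_zeta (v : Amb n) : ContDiff ℝ ∞ fun y : Amb n => zeta y v := by
  have : (fun y : Amb n => zeta y v) = fun y => xy y v - dz n v := by
    funext y; simp [zeta, xy_apply]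
  rw [this]
  exact ((ContinuousLinearMap.contDiff (ContinuousLinearMap.apply ℝ ℝ v)).comp xy.contDiff).sub
    contDiff_const

theorem contDiff_rot (v : Amb n) : ContDiff ℝ ∞ fun y : Amb n => rot y v := by
  have : (fun y : Amb n => rot y v) = fun y => rot 0 v - xx v y • vecZ n := by
    funext y
    have := rot_add_smul 0 y v 1
    simpa using this
  rw [this]
  exact contDiff_const.sub ((xx v).contDiff.smul contDiff_const)

theorem contDiff_hor (v : Amb n) : ContDiff ℝ ∞ fun y : Amb n => hor y v := by
  simp only [hor_apply]
  exact (contDiff_const.sub ((contDiff_zeta v).smul contDiff_const)).sub contDiff_const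

end

end Heisenberg

/-! ### The Levi-Civita connection of a diagonal left-invariant metric. -/

namespace Heisenberg

noncomputable section

open ChartGeometry

variable {n : ℕ}

/-- The left-invariant metric `A ∑ (σᵢ² + ρᵢ²) + B ζ² + C dq²`, where `A, B, C` depend on `q`. -/
def diagMetric (A B C : ℝ → ℝ) (p : Amb n) : Amb n →L[ℝ] Amb n →L[ℝ] ℝ :=
  A p.2 • (xx + yy) + B p.2 • sq (zeta p) + C p.2 • sq (dq n)

theorem diagMetric_apply (A B C : ℝ → ℝ) (p u v : Amb n) :
    diagMetric A B C p u v =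
      A p.2 * (xx u v + yy u v) + B p.2 * (zeta p u * zeta p v) + C p.2 * (dq n u * dq n v) := by
  simp [diagMetric, sq, mul_add]

/-- The symmetric vector-valued bilinear form that gives the Christoffel symbols of a metric
`diagMetric A B C` at a point `p`; the coefficients are `a = A'/2A`, `b = B/2A`, `c = B'/2B`,
`d = A'/2C`, `e = B'/2C`, `k = C'/2C`. -/
def diagGamma (a b c d e k : ℝ) (p u v : Amb n) : Amb n :=
  a • (dq n u • hor p v + dq n v • hor p u) + b • (zeta p v • rot p u + zeta p u • rot p v)
    + (c * (dq n u * zeta p v + dq n v * zeta p u) + 1 / 2 * (xy u v + xy v u)) • vecZ n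
    + (-(d * (xx u v + yy u v)) - e * (zeta p u * zeta p v) + k * (dq n u * dq n v)) • vecQ n

/-- `A, B, C` are the coefficients of a metric on the interval `I`, and `a, b, c, d, e, k` those of
its Christoffel symbols. -/
structure DiagData (I : Set ℝ) (A B C a b c d e k : ℝ → ℝ) : Prop where
  isOpen : IsOpen I
  posA : ∀ q ∈ I, 0 < A q
  posB : ∀ q ∈ I, 0 < B q
  posC : ∀ q ∈ I, 0 < C q
  derivA : ∀ q ∈ I, HasDerivAt A (2 * (a q * A q)) q
  derivB : ∀ q ∈ I, HasDerivAt B (2 * (c q * B q)) q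
  derivC : ∀ q ∈ I, HasDerivAt C (2 * (k q * C q)) q
  eq_b : ∀ q ∈ I, B q = 2 * (b q * A q)
  eq_d : ∀ q ∈ I, a q * A q = d q * C q
  eq_e : ∀ q ∈ I, c q * B q = e q * C q
  smoothA : ContDiffOn ℝ ∞ A I
  smoothB : ContDiffOn ℝ ∞ B I
  smoothC : ContDiffOn ℝ ∞ C I
  smooth_a : ContDiffOn ℝ ∞ a I
  smooth_b : ContDiffOn ℝ ∞ b I
  smooth_c : ContDiffOn ℝ ∞ c I
  smooth_d : ContDiffOn ℝ ∞ d I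
  smooth_e : ContDiffOn ℝ ∞ e I
  smooth_k : ContDiffOn ℝ ∞ k I

theorem contDiffOn_comp_snd {f : ℝ → ℝ} {I : Set ℝ} (h : ContDiffOn ℝ ∞ f I) :
    ContDiffOn ℝ ∞ (fun p : Amb n => f p.2) {p | p.2 ∈ I} :=
  h.comp contDiff_snd.contDiffOn fun _ hp => hp

theorem isOpen_snd_mem {I : Set ℝ} (hI : IsOpen I) : IsOpen {p : Amb n | p.2 ∈ I} :=
  hI.preimage continuous_snd

theorem contDiffOn_diagMetric {A B C : ℝ → ℝ} {I : Set ℝ} (hA : ContDiffOn ℝ ∞ A I)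
    (hB : ContDiffOn ℝ ∞ B I) (hC : ContDiffOn ℝ ∞ C I) :
    ContDiffOn ℝ ∞ (diagMetric A B C : Amb n → _) {p | p.2 ∈ I} := by
  refine contDiffOn_clm_apply.2 fun u => contDiffOn_clm_apply.2 fun v => ?_
  simp only [diagMetric_apply]
  exact (((contDiffOn_comp_snd hA).mul contDiffOn_const).add ((contDiffOn_comp_snd hB).mul
    ((contDiff_zeta u).mul (contDiff_zeta v)).contDiffOn)).add
    ((contDiffOn_comp_snd hC).mul contDiffOn_const)

theorem diagMetric_pos {A B C : ℝ → ℝ} {p : Amb n} (hA : 0 < A p.2) (hB : 0 < B p.2)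
    (hC : 0 < C p.2) {v : Amb n} (hv : v ≠ 0) : 0 < diagMetric A B C p v v := by
  have hx : 0 ≤ xx v v := by
    rw [xx_apply]; exact Finset.sum_nonneg fun i _ => mul_self_nonneg _
  have hy : 0 ≤ yy v v := by
    rw [yy_apply]; exact Finset.sum_nonneg fun i _ => mul_self_nonneg _
  have hz := mul_self_nonneg (zeta p v)
  have hq := mul_self_nonneg (dq n v)
  rw [diagMetric_apply]
  by_contra hneg
  have h1 := mul_nonneg hA.le (add_nonneg hx hy)
  have h2 := mul_nonneg hB.le hz
  have h3 := mul_nonneg hC.le hq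
  have e1 : xx v v + yy v v = 0 :=
    (mul_eq_zero.1 (show A p.2 * (xx v v + yy v v) = 0 by linarith)).resolve_left hA.ne'
  have e2 := mul_self_eq_zero.1 ((mul_eq_zero.1
    (show B p.2 * (zeta p v * zeta p v) = 0 by linarith)).resolve_left hB.ne')
  have e3 := mul_self_eq_zero.1 ((mul_eq_zero.1
    (show C p.2 * (dq n v * dq n v) = 0 by linarith)).resolve_left hC.ne')
  have ex : ∀ i, sigma i v = 0 := fun i => by
    have : xx v v = 0 := by linarith
    rw [xx_apply, Finset.sum_eq_zero_iff_of_nonneg fun i _ => mul_self_nonneg _] at this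
    exact mul_self_eq_zero.1 (this i (Finset.mem_univ i))
  have ey : ∀ i, rho i v = 0 := fun i => by
    have : yy v v = 0 := by linarith
    rw [yy_apply, Finset.sum_eq_zero_iff_of_nonneg fun i _ => mul_self_nonneg _] at this
    exact mul_self_eq_zero.1 (this i (Finset.mem_univ i))
  apply hv
  rw [frame_expansion p v]
  simp [ex, ey, e2, e3]

section connection

variable {I : Set ℝ} {A B C a b c d e k : ℝ → ℝ}

theorem DiagData.isRiemannianMetricOn (h : DiagData I A B C a b c d e k) :
    IsRiemannianMetricOn {p : Amb n | p.2 ∈ I} (diagMetric A B C) where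
  isOpen := isOpen_snd_mem h.isOpen
  smooth := contDiffOn_diagMetric h.smoothA h.smoothB h.smoothC
  symm p _ u v := by
    rw [diagMetric_apply, diagMetric_apply, xx_comm u, yy_comm u]
    ring
  pos p hp _ hv := diagMetric_pos (h.posA _ hp) (h.posB _ hp) (h.posC _ hp) hv

theorem DiagData.differentiableAt (h : DiagData I A B C a b c d e k)
    {p : Amb n} (hp : p.2 ∈ I) :
    DifferentiableAt ℝ (diagMetric A B C : Amb n → _) p :=
  ((contDiffOn_diagMetric h.smoothA h.smoothB h.smoothC).contDiffAt
    ((isOpen_snd_mem h.isOpen).mem_nhds hp)).differentiableAt (by simp)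

theorem fderiv_apply_apply {V W : Type*} [NormedAddCommGroup V] [NormedSpace ℝ V]
    [NormedAddCommGroup W] [NormedSpace ℝ W] {g : V → V →L[ℝ] V →L[ℝ] W} {p : V}
    (hg : DifferentiableAt ℝ g p) (w u v : V) :
    fderiv ℝ g p w u v = fderiv ℝ (fun y => g y u v) p w := by
  have h1 : HasFDerivAt (fun y => g y u) _ p :=
    hg.hasFDerivAt.clm_apply (hasFDerivAt_const u p)
  have h2 : HasFDerivAt (fun y => g y u v) _ p := h1.clm_apply (hasFDerivAt_const v p)
  rw [h2.fderiv]
  simp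

theorem DiagData.fderiv_diagMetric (h : DiagData I A B C a b c d e k)
    {p : Amb n} (hp : p.2 ∈ I) (w u v : Amb n) :
    fderiv ℝ (diagMetric A B C) p w u v =
      2 * (a p.2 * A p.2) * dq n w * (xx u v + yy u v)
        + (2 * (c p.2 * B p.2) * dq n w * (zeta p u * zeta p v)
        + B p.2 * (xy w u * zeta p v + zeta p u * xy w v))
        + 2 * (k p.2 * C p.2) * dq n w * (dq n u * dq n v) := by
  have hd := h.differentiableAt hp
  rw [fderiv_apply_apply hd]
  refine fderiv_eq_of_hasLineDerivAt
    ((hd.clm_apply (differentiableAt_const u)).clm_apply (differentiableAt_const v)) ?_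
  simp only [diagMetric_apply]
  have h1 := HasDerivAt.mul_const (hasLineDerivAt_comp_snd (h.derivA _ hp) w) (xx u v + yy u v)
  have h2 := HasDerivAt.mul (hasLineDerivAt_comp_snd (h.derivB _ hp) w)
    (HasDerivAt.mul (hasLineDerivAt_zeta p w u) (hasLineDerivAt_zeta p w v))
  have h3 := HasDerivAt.mul_const (hasLineDerivAt_comp_snd (h.derivC _ hp) w) (dq n u * dq n v)
  exact ((h1.add h2).add h3).congr_deriv (by simp)

/-- The connection is guessed and then verified, so no matrix is inverted. The relations `eq_b`,
`eq_d`, `eq_e` are the only link between connection coefficients of different blocks of the metric.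
-/
theorem DiagData.koszul_eq (h : DiagData I A B C a b c d e k)
    {p : Amb n} (hp : p.2 ∈ I) (u v : Amb n) :
    koszul (diagMetric A B C) p u v = diagMetric A B C p
      (diagGamma (a p.2) (b p.2) (c p.2) (d p.2) (e p.2) (k p.2) p u v) := by
  refine ContinuousLinearMap.ext fun w => ?_
  rw [koszul_apply, h.fderiv_diagMetric hp, h.fderiv_diagMetric hp, h.fderiv_diagMetric hp,
    diagMetric_apply, diagGamma]
  have e1 := h.eq_b _ hp
  have e2 := h.eq_d _ hp
  have e3 := h.eq_e _ hp
  simp [hor_apply]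
  linear_combination (-(dq n w * (xx u v + yy u v))) * e2 - dq n w * zeta p u * zeta p v * e3
    + (1 / 2 * (zeta p v * (xy u w - xy w u) + zeta p u * (xy v w - xy w v))) * e1

theorem DiagData.christoffel_eq (h : DiagData I A B C a b c d e k)
    {p : Amb n} (hp : p.2 ∈ I) (u v : Amb n) :
    christoffel (diagMetric A B C) p u v =
      diagGamma (a p.2) (b p.2) (c p.2) (d p.2) (e p.2) (k p.2) p u v := by
  rw [christoffel_apply, h.koszul_eq hp]
  exact inverse_apply_of_pos _ (fun v hv =>
    diagMetric_pos (h.posA _ hp) (h.posB _ hp) (h.posC _ hp) hv) _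

theorem DiagData.contDiffOn_christoffel (h : DiagData I A B C a b c d e k) :
    ContDiffOn ℝ ∞ (christoffel (diagMetric A B C) : Amb n → _) {p | p.2 ∈ I} := by
  refine contDiffOn_clm_apply.2 fun u => contDiffOn_clm_apply.2 fun v => ?_
  refine ContDiffOn.congr ?_ fun p hp => h.christoffel_eq hp u v
  have zu := (contDiff_zeta u).contDiffOn (s := {p : Amb n | p.2 ∈ I})
  have zv := (contDiff_zeta v).contDiffOn (s := {p : Amb n | p.2 ∈ I})
  have hu := (contDiff_hor u).contDiffOn (s := {p : Amb n | p.2 ∈ I})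
  have hv := (contDiff_hor v).contDiffOn (s := {p : Amb n | p.2 ∈ I})
  have ru := (contDiff_rot u).contDiffOn (s := {p : Amb n | p.2 ∈ I})
  have rv := (contDiff_rot v).contDiffOn (s := {p : Amb n | p.2 ∈ I})
  have sa := contDiffOn_comp_snd (n := n) h.smooth_a
  have sb := contDiffOn_comp_snd (n := n) h.smooth_b
  have sc := contDiffOn_comp_snd (n := n) h.smooth_c
  have sd := contDiffOn_comp_snd (n := n) h.smooth_d
  have se := contDiffOn_comp_snd (n := n) h.smooth_e
  have sk := contDiffOn_comp_snd (n := n) h.smooth_k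
  exact (((sa.smul ((hv.const_smul (dq n u)).add (hu.const_smul (dq n v)))).add
    (sb.smul ((zv.smul ru).add (zu.smul rv)))).add
    (((sc.mul ((contDiffOn_const.mul zv).add (contDiffOn_const.mul zu))).add
      contDiffOn_const).smul contDiffOn_const)).add
    ((((sd.mul contDiffOn_const).neg.sub (se.mul (zu.mul zv))).add
      (sk.mul contDiffOn_const)).smul contDiffOn_const)

/-- Besides the derivatives of the six coefficients, terms arise from the moving frame: `zeta`
contributes through `xy`, while `hor` and `rot` contribute the `Z` terms with factors `-a` and `-b`.
-/
theorem DiagData.fderiv_christoffel (h : DiagData I A B C a b c d e k)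
    {p : Amb n} (hp : p.2 ∈ I) (u v w : Amb n) :
    fderiv ℝ (christoffel (diagMetric A B C)) p u v w =
      (deriv a p.2 * dq n u) • (dq n v • hor p w + dq n w • hor p v)
      + (deriv b p.2 * dq n u) • (zeta p w • rot p v + zeta p v • rot p w)
      + b p.2 • (xy u w • rot p v + xy u v • rot p w)
      + (deriv c p.2 * dq n u * (dq n v * zeta p w + dq n w * zeta p v)
        + c p.2 * (dq n v * xy u w + dq n w * xy u v)
        - a p.2 * (dq n v * xy u w + dq n w * xy u v)
        - b p.2 * (zeta p w * xx v u + zeta p v * xx w u)) • vecZ n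
      + (-(deriv d p.2 * dq n u * (xx v w + yy v w))
        - deriv e p.2 * dq n u * (zeta p v * zeta p w)
        - e p.2 * (xy u v * zeta p w + zeta p v * xy u w)
        + deriv k p.2 * dq n u * (dq n v * dq n w)) • vecQ n := by
  have hnhds := (isOpen_snd_mem (n := n) h.isOpen).mem_nhds hp
  have hd : DifferentiableAt ℝ (christoffel (diagMetric A B C) : Amb n → _) p :=
    (h.contDiffOn_christoffel.contDiffAt hnhds).differentiableAt (by simp)
  have hder : ∀ {f : ℝ → ℝ}, ContDiffOn ℝ ∞ f I →
      HasLineDerivAt ℝ (fun y : Amb n => f y.2) (deriv f p.2 * dq n u) p u := fun hf =>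
    hasLineDerivAt_comp_snd ((hf.contDiffAt (h.isOpen.mem_nhds hp)).differentiableAt
      (by simp)).hasDerivAt u
  rw [fderiv_apply_apply hd]
  have hcongr : (fun y => christoffel (diagMetric A B C) y v w) =ᶠ[nhds p] fun y =>
      diagGamma (a y.2) (b y.2) (c y.2) (d y.2) (e y.2) (k y.2) y v w := by
    filter_upwards [hnhds] with y hy using h.christoffel_eq hy v w
  have hd2 : DifferentiableAt ℝ (fun y => christoffel (diagMetric A B C) y v w) p :=
    (hd.clm_apply (differentiableAt_const v)).clm_apply (differentiableAt_const w)
  rw [hcongr.fderiv_eq]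
  refine fderiv_eq_of_hasLineDerivAt (hd2.congr_of_eventuallyEq hcongr.symm) ?_
  have zv := hasLineDerivAt_zeta p u v
  have zw := hasLineDerivAt_zeta p u w
  have h1 := HasDerivAt.smul (hder h.smooth_a)
    (HasDerivAt.add (HasDerivAt.const_smul (dq n v) (hasLineDerivAt_hor p u w))
      (HasDerivAt.const_smul (dq n w) (hasLineDerivAt_hor p u v)))
  have h2 := HasDerivAt.smul (hder h.smooth_b)
    (HasDerivAt.add (HasDerivAt.smul zw (hasLineDerivAt_rot p u v))
      (HasDerivAt.smul zv (hasLineDerivAt_rot p u w)))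
  have h3 := HasDerivAt.smul_const (HasDerivAt.add_const (1 / 2 * (xy v w + xy w v))
    (HasDerivAt.mul (hder h.smooth_c)
      (HasDerivAt.add (HasDerivAt.const_mul (dq n v) zw) (HasDerivAt.const_mul (dq n w) zv))))
    (vecZ n)
  have h4 := HasDerivAt.smul_const (HasDerivAt.add (HasDerivAt.sub
    (HasDerivAt.neg (HasDerivAt.mul_const (hder h.smooth_d) (xx v w + yy v w)))
    (HasDerivAt.mul (hder h.smooth_e) (HasDerivAt.mul zv zw)))
    (HasDerivAt.mul_const (hder h.smooth_k) (dq n v * dq n w))) (vecQ n)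
  refine (((h1.add h2).add h3).add h4).congr_deriv ?_
  simp
  module

end connection

end

end Heisenberg

/-! ### Ricci tensor, Hessian and gradient. -/

namespace Heisenberg

noncomputable section

open ChartGeometry

variable {n : ℕ}

section components

variable (a b c d e k : ℝ) (p u v : Amb n) (i : Fin n)

@[simp] theorem sigma_hor : sigma i (hor p u) = sigma i u := by simp [hor_apply]
@[simp] theorem rho_hor : rho i (hor p u) = rho i u := by simp [hor_apply]
@[simp] theorem zeta_hor : zeta p (hor p u) = 0 := by simp [hor_apply]
@[simp] theorem dq_hor : dq n (hor p u) = 0 := by simp [hor_apply]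
@[simp] theorem xx_hor_right : xx u (hor p v) = xx u v := by simp [hor_apply]
@[simp] theorem yy_hor_right : yy u (hor p v) = yy u v := by simp [hor_apply]
@[simp] theorem xy_hor_left : xy (hor p u) v = xy u v := by simp [hor_apply]
@[simp] theorem xy_hor_right : xy u (hor p v) = xy u v := by simp [hor_apply]

theorem sigma_diagGamma : sigma i (diagGamma a b c d e k p u v) =
    a * (dq n u * sigma i v + dq n v * sigma i u)
      - b * (zeta p v * rho i u + zeta p u * rho i v) := by
  simp [diagGamma]; ring

theorem rho_diagGamma : rho i (diagGamma a b c d e k p u v) =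
    a * (dq n u * rho i v + dq n v * rho i u)
      + b * (zeta p v * sigma i u + zeta p u * sigma i v) := by
  simp [diagGamma]; ring

theorem zeta_diagGamma : zeta p (diagGamma a b c d e k p u v) =
    c * (dq n u * zeta p v + dq n v * zeta p u) + 1 / 2 * (xy u v + xy v u) := by
  simp [diagGamma]

theorem dq_diagGamma : dq n (diagGamma a b c d e k p u v) =
    -(d * (xx u v + yy u v)) - e * (zeta p u * zeta p v) + k * (dq n u * dq n v) := by
  simp [diagGamma]

theorem xx_diagGamma_right (w : Amb n) : xx w (diagGamma a b c d e k p u v) =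
    a * (dq n u * xx w v + dq n v * xx w u)
      - b * (zeta p v * xy w u + zeta p u * xy w v) := by
  simp [diagGamma]; ring

theorem yy_diagGamma_right (w : Amb n) : yy w (diagGamma a b c d e k p u v) =
    a * (dq n u * yy w v + dq n v * yy w u)
      + b * (zeta p v * xy u w + zeta p u * xy v w) := by
  simp [diagGamma]; ring

theorem xy_diagGamma_right (w : Amb n) : xy w (diagGamma a b c d e k p u v) =
    a * (dq n u * xy w v + dq n v * xy w u)
      + b * (zeta p v * xx w u + zeta p u * xx w v) := by
  simp [diagGamma]; ring

theorem xy_diagGamma_left (w : Amb n) : xy (diagGamma a b c d e k p u v) w =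
    a * (dq n u * xy v w + dq n v * xy u w)
      - b * (zeta p v * yy u w + zeta p u * yy v w) := by
  simp [diagGamma]; ring

end components

section ricci

variable {I : Set ℝ} {A B C a b c d e k : ℝ → ℝ}

/-- One of the four kinds of diagonal entries that the trace requires. The part in the first
parentheses is independent of `i` and is what produces the factors `n` in the Ricci tensor. The
coefficient `3 / 2 * b = 3 * B / (4 * A)` is the negative curvature contribution of the bracket
`[Xᵢ, Yᵢ] = -Z`. -/
theorem DiagData.sigma_curvature_vecX (h : DiagData I A B C a b c d e k) {p : Amb n}
    (hp : p.2 ∈ I) (v w : Amb n) (i : Fin n) :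
    sigma i (curvature (diagMetric A B C) p v w (vecX i)) =
      (-deriv a p.2 * (dq n v * dq n w)
        + a p.2 * (-(d p.2 * (xx v w + yy v w)) - e p.2 * (zeta p v * zeta p w)
          + k p.2 * (dq n v * dq n w))
        - a p.2 ^ 2 * (dq n v * dq n w) + b p.2 ^ 2 * (zeta p v * zeta p w))
      + a p.2 * d p.2 * (sigma i v * sigma i w)
      - 3 / 2 * b p.2 * (rho i v * rho i w) := by
  rw [curvature_apply, h.fderiv_christoffel hp, h.fderiv_christoffel hp]
  simp only [h.christoffel_eq hp]
  simp [sigma_diagGamma, rho_diagGamma, zeta_diagGamma, dq_diagGamma]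
  ring

theorem DiagData.rho_curvature_vecY (h : DiagData I A B C a b c d e k) {p : Amb n}
    (hp : p.2 ∈ I) (v w : Amb n) (i : Fin n) :
    rho i (curvature (diagMetric A B C) p v w (vecY i p)) =
      (-deriv a p.2 * (dq n v * dq n w)
        + a p.2 * (-(d p.2 * (xx v w + yy v w)) - e p.2 * (zeta p v * zeta p w)
          + k p.2 * (dq n v * dq n w))
        - a p.2 ^ 2 * (dq n v * dq n w) + b p.2 ^ 2 * (zeta p v * zeta p w))
      + a p.2 * d p.2 * (rho i v * rho i w)
      - 3 / 2 * b p.2 * (sigma i v * sigma i w) := by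
  rw [curvature_apply, h.fderiv_christoffel hp, h.fderiv_christoffel hp]
  simp only [h.christoffel_eq hp]
  simp [sigma_diagGamma, rho_diagGamma, zeta_diagGamma, dq_diagGamma]
  ring

theorem DiagData.zeta_curvature_vecZ (h : DiagData I A B C a b c d e k) {p : Amb n}
    (hp : p.2 ∈ I) (v w : Amb n) :
    zeta p (curvature (diagMetric A B C) p v w (vecZ n)) =
      -deriv c p.2 * (dq n v * dq n w) + b p.2 * xx v w
        + c p.2 * (-(d p.2 * (xx v w + yy v w)) - e p.2 * (zeta p v * zeta p w)
          + k p.2 * (dq n v * dq n w))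
        - c p.2 ^ 2 * (dq n v * dq n w) + c p.2 * e p.2 * (zeta p v * zeta p w)
        - 1 / 2 * b p.2 * (xx v w - yy v w) := by
  rw [curvature_apply, h.fderiv_christoffel hp, h.fderiv_christoffel hp]
  simp only [h.christoffel_eq hp]
  simp [zeta_diagGamma, dq_diagGamma, xy_diagGamma_right, xy_diagGamma_left]
  rw [xx_comm w v, yy_comm w v]
  ring

theorem DiagData.dq_curvature_vecQ (h : DiagData I A B C a b c d e k) {p : Amb n}
    (hp : p.2 ∈ I) (v w : Amb n) :
    dq n (curvature (diagMetric A B C) p v w (vecQ n)) =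
      -(deriv d p.2 * (xx v w + yy v w)) - deriv e p.2 * (zeta p v * zeta p w)
        + k p.2 * (-(d p.2 * (xx v w + yy v w)) - e p.2 * (zeta p v * zeta p w)
          + k p.2 * (dq n v * dq n w))
        + d p.2 * a p.2 * (xx v w + yy v w) + e p.2 * c p.2 * (zeta p v * zeta p w)
        - k p.2 ^ 2 * (dq n v * dq n w) := by
  rw [curvature_apply, h.fderiv_christoffel hp, h.fderiv_christoffel hp]
  simp only [h.christoffel_eq hp]
  simp [zeta_diagGamma, dq_diagGamma, xx_diagGamma_right, yy_diagGamma_right]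
  ring

/-- The Ricci tensor of a metric `diagMetric A B C` is diagonal in the same coframe. -/
theorem DiagData.ricci_eq (h : DiagData I A B C a b c d e k) {p : Amb n} (hp : p.2 ∈ I)
    (v w : Amb n) :
    ricci (diagMetric A B C) p v w =
      (-deriv d p.2 - (2 * n * a p.2 + c p.2 + k p.2) * d p.2 + 2 * (a p.2 * d p.2) - b p.2)
          * (xx v w + yy v w)
        + (-deriv e p.2 - (2 * n * a p.2 + c p.2 + k p.2) * e p.2 + 2 * n * b p.2 ^ 2
          + 2 * (c p.2 * e p.2)) * (zeta p v * zeta p w)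
        + (-(2 * n * deriv a p.2 + deriv c p.2) + (2 * n * a p.2 + c p.2) * k p.2
          - 2 * n * a p.2 ^ 2 - c p.2 ^ 2) * (dq n v * dq n w) := by
  rw [ricci, trace_eq_sum p]
  simp only [h.sigma_curvature_vecX hp, h.rho_curvature_vecY hp, h.zeta_curvature_vecZ hp,
    h.dq_curvature_vecQ hp]
  simp only [Finset.sum_add_distrib, Finset.sum_sub_distrib, ← Finset.mul_sum, ← xx_apply,
    ← yy_apply, Finset.sum_const, Finset.card_univ, Fintype.card_fin, nsmul_eq_mul]
  ring

theorem hessian_comp_snd (g : Amb n → Amb n →L[ℝ] Amb n →L[ℝ] ℝ) {f f' : ℝ → ℝ} {f'' : ℝ}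
    (hI : IsOpen I) (hf : ∀ q ∈ I, HasDerivAt f (f' q) q) {p : Amb n} (hp : p.2 ∈ I)
    (hf' : HasDerivAt f' f'' p.2) (v w : Amb n) :
    hessian g (fun y => f y.2) p v w =
      f'' * (dq n v * dq n w) - f' p.2 * dq n (christoffel g p v w) := by
  have h1 : ∀ y : Amb n, y.2 ∈ I → HasFDerivAt (fun y : Amb n => f y.2) (f' y.2 • dq n) y :=
    fun y hy => (hf _ hy).comp_hasFDerivAt y (dq n).hasFDerivAt
  have h2 : fderiv ℝ (fun y : Amb n => f y.2) =ᶠ[nhds p] fun y => f' y.2 • dq n := by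
    filter_upwards [(isOpen_snd_mem (n := n) hI).mem_nhds hp] with y hy using (h1 y hy).fderiv
  have h3 : HasFDerivAt (fun y : Amb n => f' y.2 • dq n) _ p :=
    (hf'.comp_hasFDerivAt p (dq n).hasFDerivAt).smul_const (dq n)
  rw [hessian, h2.fderiv_eq, h3.fderiv, (h1 p hp).fderiv]
  simp
  ring

theorem DiagData.gradient_comp_snd (h : DiagData I A B C a b c d e k) {f : ℝ → ℝ} {f' : ℝ}
    {p : Amb n} (hp : p.2 ∈ I) (hf : HasDerivAt f f' p.2) :
    ChartGeometry.gradient (diagMetric A B C) (fun y => f y.2) p = (f' / C p.2) • vecQ n := by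
  have h1 : HasFDerivAt (fun y : Amb n => f y.2) (f' • dq n) p :=
    hf.comp_hasFDerivAt p (dq n).hasFDerivAt
  have h2 : f' • dq n = diagMetric A B C p ((f' / C p.2) • vecQ n) := by
    refine ContinuousLinearMap.ext fun w => ?_
    have := (h.posC _ hp).ne'
    rw [diagMetric_apply]
    simp
    field_simp
  rw [ChartGeometry.gradient, h1.fderiv, h2]
  exact inverse_apply_of_pos _ (fun v hv =>
    diagMetric_pos (h.posA _ hp) (h.posB _ hp) (h.posC _ hp) hv) _

end ricci

end

end Heisenberg

/-! ### The complex structure and the Kähler condition. -/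

namespace Heisenberg

noncomputable section

open ChartGeometry

variable {n : ℕ}

/-- The almost complex structure with `J Xᵢ = Yᵢ` and `J ∂_q = m(q) Z`. -/
def diagCplx (m : ℝ → ℝ) (p : Amb n) : Amb n →L[ℝ] Amb n :=
  rot p + m p.2 • (dq n).smulRight (vecZ n) - (m p.2)⁻¹ • (zeta p).smulRight (vecQ n)

theorem diagCplx_apply (m : ℝ → ℝ) (p u : Amb n) :
    diagCplx m p u = rot p u + (m p.2 * dq n u) • vecZ n - ((m p.2)⁻¹ * zeta p u) • vecQ n := by
  simp [diagCplx, smul_smul]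

theorem contDiffOn_diagCplx {m : ℝ → ℝ} {I : Set ℝ} (hm : ContDiffOn ℝ ∞ m I)
    (hpos : ∀ q ∈ I, 0 < m q) : ContDiffOn ℝ ∞ (diagCplx m : Amb n → _) {p | p.2 ∈ I} := by
  refine contDiffOn_clm_apply.2 fun u => ?_
  simp only [diagCplx_apply]
  have sm := contDiffOn_comp_snd (n := n) hm
  have sm' := contDiffOn_comp_snd (n := n) (hm.inv fun q hq => (hpos q hq).ne')
  exact ((contDiff_rot u).contDiffOn.add ((sm.mul contDiffOn_const).smul contDiffOn_const)).sub
    ((sm'.mul (contDiff_zeta u).contDiffOn).smul contDiffOn_const)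

theorem diagCplx_sq {m : ℝ → ℝ} {p : Amb n} (hm : 0 < m p.2) (u : Amb n) :
    diagCplx m p (diagCplx m p u) = -u := by
  have hm' := hm.ne'
  simp only [diagCplx_apply, map_add, map_sub, map_smul, rot_rot, rot_vecZ, rot_vecQ, dq_rot,
    zeta_rot, dq_vecZ, dq_vecQ, zeta_vecZ, zeta_vecQ, hor_apply]
  match_scalars <;> field_simp <;> simp

theorem fderiv_diagCplx {m : ℝ → ℝ} {I : Set ℝ} (hI : IsOpen I) (hm : ContDiffOn ℝ ∞ m I)
    (hpos : ∀ q ∈ I, 0 < m q) {p : Amb n} (hp : p.2 ∈ I) (w u : Amb n) :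
    fderiv ℝ (fun y => diagCplx m y u) p w =
      (deriv m p.2 * dq n w * dq n u - xx u w) • vecZ n
        + (deriv m p.2 / m p.2 ^ 2 * dq n w * zeta p u - (m p.2)⁻¹ * xy w u) • vecQ n := by
  have hnhds := (isOpen_snd_mem (n := n) hI).mem_nhds hp
  have hd : DifferentiableAt ℝ (diagCplx m : Amb n → _) p :=
    ((contDiffOn_diagCplx hm hpos).contDiffAt hnhds).differentiableAt (by simp)
  refine fderiv_eq_of_hasLineDerivAt (hd.clm_apply (differentiableAt_const u)) ?_
  have hm1 : HasDerivAt m (deriv m p.2) p.2 :=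
    ((hm.contDiffAt (hI.mem_nhds hp)).differentiableAt (by simp)).hasDerivAt
  have hm2 := hm1.inv (hpos _ hp).ne'
  simp only [diagCplx_apply]
  have h1 := HasDerivAt.smul_const (HasDerivAt.mul_const (hasLineDerivAt_comp_snd hm1 w)
    (dq n u)) (vecZ n)
  have h2 := HasDerivAt.smul_const (HasDerivAt.mul (hasLineDerivAt_comp_snd hm2 w)
    (hasLineDerivAt_zeta p w u)) (vecQ n)
  refine ((HasDerivAt.add (hasLineDerivAt_rot p w u) h1).sub h2).congr_deriv ?_
  simp
  module

/-- In the frame `Xᵢ, Yᵢ, Z, m⁻¹ ∂_q` the structure `J` has constant coefficients and the only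
nonzero brackets are `[Xᵢ, Yᵢ] = -Z`. Their contributions to the Nijenhuis tensor cancel, whatever
`m` is. -/
theorem nijenhuis_diagCplx {m : ℝ → ℝ} {I : Set ℝ} (hI : IsOpen I) (hm : ContDiffOn ℝ ∞ m I)
    (hpos : ∀ q ∈ I, 0 < m q) {p : Amb n} (hp : p.2 ∈ I) (u v : Amb n) :
    nijenhuis (diagCplx m) p u v = 0 := by
  have hm' := (hpos _ hp).ne'
  simp only [nijenhuis, VectorField.lieBracket, fderiv_diagCplx hI hm hpos hp, fderiv_fun_const,
    Pi.zero_apply, zero_apply, zero_sub, sub_zero, map_neg]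
  simp only [diagCplx_apply, map_add, map_sub, map_smul, rot_vecZ, rot_vecQ, dq_rot,
    dq_vecZ, dq_vecQ, zeta_vecZ, zeta_vecQ, smul_eq_mul, add_apply,
    sub_apply, smul_apply, xx_rot_right, xy_rot_left,
    xx_vecZ_right, xx_vecQ_right, xy_vecZ_left, xy_vecQ_left]
  match_scalars
  · field_simp
    ring
  · field_simp
    linear_combination m p.2 ^ 2 * (xx_comm u v + yy_comm u v)

section kahler

variable {I : Set ℝ} {A B C a b c d e k m : ℝ → ℝ}

theorem kahlerForm_diagMetric (hpos : ∀ q ∈ I, 0 < m q)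
    (hC : ∀ q ∈ I, C q = m q ^ 2 * B q) {p : Amb n} (hp : p.2 ∈ I) (u v : Amb n) :
    kahlerForm (diagMetric A B C) (diagCplx m) p u v =
      A p.2 * (xy u v - xy v u) + m p.2 * B p.2 * (dq n u * zeta p v - zeta p u * dq n v) := by
  have hm' := (hpos _ hp).ne'
  change diagMetric A B C p (diagCplx m p u) v = _
  rw [diagMetric_apply, diagCplx_apply, hC _ hp]
  simp
  field_simp
  ring

theorem DiagData.fderiv_kahlerForm (h : DiagData I A B C a b c d e k)
    (hm : ContDiffOn ℝ ∞ m I) (hpos : ∀ q ∈ I, 0 < m q)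
    (hC : ∀ q ∈ I, C q = m q ^ 2 * B q) {p : Amb n} (hp : p.2 ∈ I) (w u v : Amb n) :
    fderiv ℝ (kahlerForm (diagMetric A B C) (diagCplx m)) p w u v =
      2 * (a p.2 * A p.2) * dq n w * (xy u v - xy v u)
        + deriv (fun q => m q * B q) p.2 * dq n w * (dq n u * zeta p v - zeta p u * dq n v)
        + m p.2 * B p.2 * (dq n u * xy w v - xy w u * dq n v) := by
  have hnhds := (isOpen_snd_mem (n := n) h.isOpen).mem_nhds hp
  have hg := h.differentiableAt hp
  have hJ : DifferentiableAt ℝ (diagCplx m : Amb n → _) p :=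
    ((contDiffOn_diagCplx hm hpos).contDiffAt hnhds).differentiableAt (by simp)
  have hd : DifferentiableAt ℝ (kahlerForm (diagMetric A B C : Amb n → _) (diagCplx m)) p :=
    hg.clm_comp hJ
  have hd2 := (hd.clm_apply (differentiableAt_const u)).clm_apply (differentiableAt_const v)
  have hcongr : (fun y => kahlerForm (diagMetric A B C) (diagCplx m) y u v) =ᶠ[nhds p] fun y =>
      A y.2 * (xy u v - xy v u) + m y.2 * B y.2 * (dq n u * zeta y v - zeta y u * dq n v) := by
    filter_upwards [hnhds] with y hy using kahlerForm_diagMetric hpos hC hy u v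
  rw [fderiv_apply_apply hd, hcongr.fderiv_eq]
  refine fderiv_eq_of_hasLineDerivAt (hd2.congr_of_eventuallyEq hcongr.symm) ?_
  have hmB : HasDerivAt (fun q => m q * B q) (deriv (fun q => m q * B q) p.2) p.2 :=
    (((hm.mul h.smoothB).contDiffAt (h.isOpen.mem_nhds hp)).differentiableAt (by simp)).hasDerivAt
  have h1 := HasDerivAt.mul_const (hasLineDerivAt_comp_snd (h.derivA _ hp) w) (xy u v - xy v u)
  have h2 := HasDerivAt.mul (hasLineDerivAt_comp_snd hmB w)
    (HasDerivAt.sub (HasDerivAt.const_mul (dq n u) (hasLineDerivAt_zeta p w v))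
      (HasDerivAt.mul_const (hasLineDerivAt_zeta p w u) (dq n v)))
  exact (h1.add h2).congr_deriv (by simp; ring)

/-- `hC` says that `∂_q` and `m Z` have equal length, which makes `J` orthogonal. The Kähler form is
`A dζ + m B dq ∧ ζ`, whose differential is `(A' - m B) dq ∧ dζ`; `hA` makes it vanish. -/
theorem DiagData.isKahlerOn (h : DiagData I A B C a b c d e k) (hm : ContDiffOn ℝ ∞ m I)
    (hpos : ∀ q ∈ I, 0 < m q) (hC : ∀ q ∈ I, C q = m q ^ 2 * B q)
    (hA : ∀ q ∈ I, 2 * (a q * A q) = m q * B q) :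
    IsKahlerOn {p : Amb n | p.2 ∈ I} (diagMetric A B C) (diagCplx m) where
  riemannian := h.isRiemannianMetricOn
  smooth_J := contDiffOn_diagCplx hm hpos
  sq_J p hp u := diagCplx_sq (hpos _ hp) u
  hermitian p hp u v := by
    have hm' := (hpos _ hp).ne'
    rw [diagMetric_apply, diagMetric_apply, diagCplx_apply, diagCplx_apply, hC _ hp]
    simp
    field_simp
    rw [yy_comm v u]
    ring
  integrable p hp u v := nijenhuis_diagCplx h.isOpen hm hpos hp u v
  closed p hp u v w := by
    simp only [h.fderiv_kahlerForm hm hpos hC hp]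
    linear_combination (dq n u * (xy v w - xy w v) + dq n v * (xy w u - xy u w)
      + dq n w * (xy u v - xy v u)) * hA _ hp

/-- The gradient of a function of `q` is holomorphic if it is a constant multiple of
`m⁻¹ ∂_q`. -/
theorem DiagData.gradient_holomorphic (h : DiagData I A B C a b c d e k)
    (hm : ContDiffOn ℝ ∞ m I) (hpos : ∀ q ∈ I, 0 < m q) (hC : ∀ q ∈ I, C q = m q ^ 2 * B q)
    {f : ℝ → ℝ} {κ : ℝ} (hf : ∀ q ∈ I, HasDerivAt f (κ * (m q * B q)) q) {p : Amb n}
    (hp : p.2 ∈ I) (u : Amb n) :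
    VectorField.lieBracket ℝ (ChartGeometry.gradient (diagMetric A B C) fun y => f y.2)
        (fun y => diagCplx m y u) p
      - diagCplx m p (VectorField.lieBracket ℝ
        (ChartGeometry.gradient (diagMetric A B C) fun y => f y.2) (fun _ => u) p) = 0 := by
  have hm' := (hpos _ hp).ne'
  have hnhds := (isOpen_snd_mem (n := n) h.isOpen).mem_nhds hp
  have hgrad : ∀ y : Amb n, y.2 ∈ I →
      ChartGeometry.gradient (diagMetric A B C) (fun y => f y.2) y = (κ * (m y.2)⁻¹) • vecQ n :=
    fun y hy => by
      have h1 := (hpos _ hy).ne'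
      have h2 := (h.posB _ hy).ne'
      rw [h.gradient_comp_snd hy (hf _ hy), hC _ hy]
      congr 1
      field_simp
  have hcongr : ChartGeometry.gradient (diagMetric A B C) (fun y : Amb n => f y.2) =ᶠ[nhds p]
      fun y => (κ * (m y.2)⁻¹) • vecQ n := by
    filter_upwards [hnhds] with y hy using hgrad y hy
  have hm1 : HasDerivAt m (deriv m p.2) p.2 :=
    ((hm.contDiffAt (h.isOpen.mem_nhds hp)).differentiableAt (by simp)).hasDerivAt
  have hX : HasFDerivAt (fun y : Amb n => (κ * (m y.2)⁻¹) • vecQ n) _ p :=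
    ((((hm1.inv hm').const_mul κ).comp_hasFDerivAt p (dq n).hasFDerivAt)).smul_const (vecQ n)
  simp only [VectorField.lieBracket, hcongr.fderiv_eq, hX.fderiv, hgrad p hp,
    fderiv_diagCplx h.isOpen hm hpos hp, fderiv_fun_const, Pi.zero_apply,
    zero_apply, zero_sub]
  simp only [diagCplx_apply, map_add, map_sub, map_smul, map_neg, rot_vecQ, dq_rot,
    dq_vecZ, dq_vecQ, zeta_vecQ, smul_eq_mul,
    ContinuousLinearMap.smulRight_apply, smul_apply,
    xx_vecQ_right, xy_vecQ_left]
  match_scalars <;> field_simp <;> ring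

end kahler

end

end Heisenberg

/-! ### Reduction of the soliton equation to the linear equation for `F n`. -/

namespace Heisenberg

noncomputable section

open ChartGeometry

variable {n : ℕ} {q₀ φ₀ : ℝ} {φ : ℝ → ℝ}

theorem metric_eq_diagMetric (n : ℕ) (φ : ℝ → ℝ) : metric n φ =
    diagMetric φ (fun q => deriv φ q / φ q ^ (n - 1)) fun q => φ q ^ (n - 1) * deriv φ q := by
  funext p
  refine ContinuousLinearMap.ext fun u => ContinuousLinearMap.ext fun v => ?_
  rw [diagMetric_apply]
  simp [metric, sq, xx_apply, yy_apply, Finset.sum_add_distrib, Finset.mul_sum, mul_add]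

theorem cplx_eq_diagCplx (n : ℕ) (φ : ℝ → ℝ) :
    cplx n φ = diagCplx fun q => φ q ^ (n - 1) := rfl

/-- Splitting off one factor leaves `s ^ (n - 1)` as the only power, so it can later be treated as
an independent variable. -/
theorem derivF_eq (hn : 1 ≤ n) (s : ℝ) :
    derivF n s = 2 * (s ^ (n - 1) * s) - F n s - F n s / s := by
  obtain ⟨r, rfl⟩ := Nat.exists_eq_add_of_le hn
  simp [derivF, pow_add, mul_comm]

theorem IsSolution.hasDerivAt_pow (hn : 1 ≤ n) (hφ₀ : 0 < φ₀)
    (h : IsSolution n q₀ φ₀ (interval n q₀ φ₀) φ) {q : ℝ} (hq : q ∈ interval n q₀ φ₀) :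
    HasDerivAt (fun q => φ q ^ (n - 1))
      ((n - 1) * F n (φ q) / φ q * φ q ^ (n - 1)) q := by
  have h0 := (h.pos_of_mem hφ₀ hq).ne'
  refine ((h.2 q hq).pow (n - 1)).congr_deriv ?_
  obtain ⟨r, rfl⟩ := Nat.exists_eq_add_of_le hn
  -- For `n = 1` the power is constant. Otherwise its exponent is a successor, and the truncated
  -- exponent in the power rule is the true one.
  rcases r with - | r
  · simp
  · simp only [add_tsub_cancel_left]
    push_cast
    field_simp
    simp
    ring

theorem IsSolution.hasDerivAt_F (hφ₀ : 0 < φ₀)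
    (h : IsSolution n q₀ φ₀ (interval n q₀ φ₀) φ) {q : ℝ} (hq : q ∈ interval n q₀ φ₀) :
    HasDerivAt (fun q => F n (φ q)) (derivF n (φ q) * F n (φ q)) q :=
  (Heisenberg.hasDerivAt_F n (h.pos_of_mem hφ₀ hq).ne').comp q (h.2 q hq)

theorem IsSolution.hasDerivAt_F_div (hφ₀ : 0 < φ₀)
    (h : IsSolution n q₀ φ₀ (interval n q₀ φ₀) φ) {q : ℝ} (hq : q ∈ interval n q₀ φ₀) :
    HasDerivAt (fun q => F n (φ q) / φ q)
      ((derivF n (φ q) - F n (φ q) / φ q) * F n (φ q) / φ q) q := by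
  have h0 := (h.pos_of_mem hφ₀ hq).ne'
  refine ((h.hasDerivAt_F hφ₀ hq).div (h.2 q hq) h0).congr_deriv ?_
  field_simp

theorem IsSolution.hasDerivAt_derivF (hφ₀ : 0 < φ₀)
    (h : IsSolution n q₀ φ₀ (interval n q₀ φ₀) φ) {q : ℝ} (hq : q ∈ interval n q₀ φ₀) :
    HasDerivAt (fun q => derivF n (φ q))
      ((2 * (n * φ q ^ (n - 1)) - derivF n (φ q) - (derivF n (φ q) - F n (φ q) / φ q) / φ q)
        * F n (φ q)) q := by
  have h0 := (h.pos_of_mem hφ₀ hq).ne'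
  refine ((Heisenberg.hasDerivAt_derivF n h0).comp q (h.2 q hq)).congr_deriv ?_
  field_simp

theorem IsSolution.deriv_eventuallyEq
    (h : IsSolution n q₀ φ₀ (interval n q₀ φ₀) φ) {q : ℝ} (hq : q ∈ interval n q₀ φ₀) :
    deriv φ =ᶠ[nhds q] fun q => F n (φ q) := by
  filter_upwards [(isOpen_interval n q₀ φ₀).mem_nhds hq] with y hy using (h.2 y hy).deriv

/-- The Christoffel data of the metric belonging to a solution of `φ' = F_n(φ)`. -/
theorem IsSolution.diagData (hn : 1 ≤ n) (hφ₀ : 0 < φ₀)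
    (h : IsSolution n q₀ φ₀ (interval n q₀ φ₀) φ) :
    DiagData (interval n q₀ φ₀) φ (fun q => deriv φ q / φ q ^ (n - 1))
      (fun q => φ q ^ (n - 1) * deriv φ q)
      (fun q => 1 / 2 * (F n (φ q) / φ q))
      (fun q => 1 / 2 * (F n (φ q) / φ q) / φ q ^ (n - 1))
      (fun q => 1 / 2 * (derivF n (φ q) - (n - 1) * (F n (φ q) / φ q)))
      (fun q => 1 / 2 / φ q ^ (n - 1))
      (fun q => 1 / 2 * (derivF n (φ q) - (n - 1) * (F n (φ q) / φ q))
        / φ q ^ (n - 1) / φ q ^ (n - 1))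
      (fun q => 1 / 2 * (derivF n (φ q) + (n - 1) * (F n (φ q) / φ q))) := by
  have hpos : ∀ q ∈ interval n q₀ φ₀, 0 < φ q := fun q hq => h.pos_of_mem hφ₀ hq
  have hF : ∀ q ∈ interval n q₀ φ₀, 0 < F n (φ q) := fun q hq => F_pos n (hpos q hq)
  have sφ := h.contDiffOn hφ₀
  have sF' : ContDiffOn ℝ ∞ (fun q => F n (φ q)) (interval n q₀ φ₀) :=
    (contDiffOn_F n).comp sφ hpos
  have sm := sφ.pow (n - 1)
  have hm : ∀ q ∈ interval n q₀ φ₀, φ q ^ (n - 1) ≠ 0 := fun q hq => pow_ne_zero _ (hpos q hq).ne'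
  have sFd := sF'.div sφ fun q hq => (hpos q hq).ne'
  have sK : ContDiffOn ℝ ∞ (fun q => derivF n (φ q)) (interval n q₀ φ₀) :=
    ((contDiffOn_const.mul (sφ.pow n)).sub sF').sub sFd
  have sc := contDiffOn_const (c := (1 / 2 : ℝ)) |>.mul
    (sK.sub (contDiffOn_const (c := (n - 1 : ℝ)) |>.mul sFd))
  refine
  { isOpen := isOpen_interval n q₀ φ₀
    posA := hpos
    posB := fun q hq => ?_
    posC := fun q hq => ?_
    derivA := fun q hq => ?_
    derivB := fun q hq => ?_
    derivC := fun q hq => ?_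
    eq_b := fun q hq => ?_
    eq_d := fun q hq => ?_
    eq_e := fun q hq => ?_
    smoothA := sφ
    smoothB := (sF'.div sm hm).congr fun q hq => by simp only [(h.2 q hq).deriv, Pi.div_apply]
    smoothC := (sm.mul sF').congr fun q hq => by simp only [(h.2 q hq).deriv]
    smooth_a := contDiffOn_const.mul sFd
    smooth_b := (contDiffOn_const.mul sFd).div sm hm
    smooth_c := sc
    smooth_d := contDiffOn_const.div sm hm
    smooth_e := (sc.div sm hm).div sm hm
    smooth_k := contDiffOn_const.mul (sK.add (contDiffOn_const.mul sFd)) }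
  · rw [(h.2 q hq).deriv]; exact div_pos (hF q hq) (pow_pos (hpos q hq) _)
  · rw [(h.2 q hq).deriv]; exact mul_pos (pow_pos (hpos q hq) _) (hF q hq)
  all_goals have h0 := (hpos q hq).ne'
  all_goals have h1 := hm q hq
  · refine (h.2 q hq).congr_deriv ?_
    field_simp
  · rw [(h.2 q hq).deriv]
    refine (((h.hasDerivAt_F hφ₀ hq).div (h.hasDerivAt_pow hn hφ₀ hq) h1).congr_of_eventuallyEq
      ?_).congr_deriv ?_
    · filter_upwards [h.deriv_eventuallyEq hq] with y hy
      simp [hy]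
    · field_simp
  · rw [(h.2 q hq).deriv]
    refine (((h.hasDerivAt_pow hn hφ₀ hq).mul (h.hasDerivAt_F hφ₀ hq)).congr_of_eventuallyEq
      ?_).congr_deriv ?_
    · filter_upwards [h.deriv_eventuallyEq hq] with y hy
      simp [hy]
    · field_simp
      ring
  · rw [(h.2 q hq).deriv]
    field_simp
  · rw [(h.2 q hq).deriv]
    field_simp
  · rw [(h.2 q hq).deriv]
    field_simp

/-- Both sides are diagonal in the coframe. With `m = φ ^ (n - 1)`, the coefficient of `∑ (σᵢ² +
ρᵢ²)` reads `-(F' + F + F / φ) / (2 m) = -φ`, which is the linear equation for `F n`. The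
coefficients of `ζ²` and `dq²` also involve the second derivative of `F n`, supplied by
differentiating that equation. -/
theorem IsSolution.soliton_equation (hn : 1 ≤ n) (hφ₀ : 0 < φ₀)
    (h : IsSolution n q₀ φ₀ (interval n q₀ φ₀) φ) (κ : ℝ) {p : Amb n}
    (hp : p.2 ∈ interval n q₀ φ₀) (u v : Amb n) :
    ricci (metric n φ) p u v + hessian (metric n φ) (fun p => -φ p.2 + κ) p u v =
      -1 * metric n φ p u v := by
  have D := h.diagData hn hφ₀
  have h0 := (h.pos_of_mem hφ₀ hp).ne'
  have h1 : φ p.2 ^ (n - 1) ≠ 0 := pow_ne_zero _ h0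
  have dm := h.hasDerivAt_pow hn hφ₀ hp
  have dFd := h.hasDerivAt_F_div hφ₀ hp
  have dc := ((h.hasDerivAt_derivF hφ₀ hp).sub (dFd.const_mul (n - 1 : ℝ))).const_mul (1 / 2)
  have ea := (dFd.const_mul (1 / 2)).deriv
  have ec := dc.deriv
  have ed := ((hasDerivAt_const p.2 (1 / 2 : ℝ)).div dm h1).deriv
  have ee := ((dc.div dm h1).div dm h1).deriv
  have hK := derivF_eq hn (φ p.2)
  rw [metric_eq_diagMetric, D.ricci_eq hp,
    hessian_comp_snd (f := fun q => -φ q + κ) (f' := fun q => -F n (φ q)) _ D.isOpen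
      (fun q hq => (h.2 q hq).neg.add_const κ) hp (h.hasDerivAt_F hφ₀ hp).neg,
    D.christoffel_eq hp, dq_diagGamma, diagMetric_apply, (h.2 _ hp).deriv]
  simp only [Pi.div_def, Pi.sub_def] at ea ec ed ee
  rw [ea, ec, ed, ee]
  -- With the derivatives inserted, what remains is a rational identity in `n`, `m = φ ^ (n - 1)`,
  -- `s = φ` and `f = F n φ`; `hK` is the only relation that has to be used.
  generalize xx u v + yy u v = H
  generalize zeta p u * zeta p v = Y
  generalize dq n u * dq n v = Q
  generalize φ p.2 ^ (n - 1) = m at *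
  rw [hK]
  generalize F n (φ p.2) = f at *
  generalize φ p.2 = s at *
  field_simp
  ring

end

end Heisenberg

/-! ### Curve length and Riemannian distance. -/

namespace ChartGeometry

noncomputable section

open Set Filter Topology

variable {V : Type*} [NormedAddCommGroup V] [NormedSpace ℝ V]

/-- A function whose differential is bounded by `K` along a curve varies along it by at most `K`
times the length of the curve. -/
theorem abs_sub_le_mul_of_curveLength_le {U : Set V} (hUo : IsOpen U)
    {g : V → V →L[ℝ] V →L[ℝ] ℝ} {f : V → ℝ} (hf : ContDiffOn ℝ 1 f U) {γ : ℝ → V}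
    (hγ : ContDiffOn ℝ 1 γ (Icc 0 1)) (hU : MapsTo γ (Icc 0 1) U) {K L : ℝ} (hK : 0 ≤ K)
    (hL : 0 ≤ L) (hlen : curveLength g γ ≤ ENNReal.ofReal L)
    (hb : ∀ s ∈ Icc (0 : ℝ) 1, ∀ v, |fderiv ℝ f (γ s) v| ≤ K * Real.sqrt (g (γ s) v v))
    {t : ℝ} (ht : t ∈ Icc (0 : ℝ) 1) : |f (γ t) - f (γ 0)| ≤ K * L := by
  have hfγ : ContDiffOn ℝ 1 (fun s => f (γ s)) (Icc 0 1) := hf.comp hγ hU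
  have hsub : Icc 0 t ⊆ Icc (0 : ℝ) 1 := Icc_subset_Icc_right ht.2
  have h1 := enorm_sub_le_lintegral_deriv_of_contDiffOn_Icc (hfγ.mono hsub) ht.1
  -- At interior times `derivWithin` is the two-sided derivative, so the chain rule applies; the
  -- endpoints have measure zero.
  have hder : ∀ s ∈ Ioo 0 t, ‖deriv (fun s => f (γ s)) s‖ₑ ≤ ENNReal.ofReal K *
      ENNReal.ofReal (Real.sqrt (g (γ s) (derivWithin γ (Icc 0 1) s)
        (derivWithin γ (Icc 0 1) s))) := fun s hs => by
    have hs1 : s ∈ Icc (0 : ℝ) 1 := hsub (Ioo_subset_Icc_self hs)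
    have hn : Icc (0 : ℝ) 1 ∈ 𝓝 s := Icc_mem_nhds hs.1 (hs.2.trans_le ht.2)
    have d1 : HasDerivAt γ (derivWithin γ (Icc 0 1) s) s :=
      ((hγ.differentiableOn one_ne_zero) s hs1).hasDerivWithinAt.hasDerivAt hn
    have d2 : HasFDerivAt f (fderiv ℝ f (γ s)) (γ s) :=
      ((hf.contDiffAt (hUo.mem_nhds (hU hs1))).differentiableAt one_ne_zero).hasFDerivAt
    have d3 : HasDerivAt (fun s => f (γ s)) _ s := d2.comp_hasDerivAt s d1
    rw [d3.deriv, ← ENNReal.ofReal_mul hK, Real.enorm_eq_ofReal_abs]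
    exact ENNReal.ofReal_le_ofReal (hb s hs1 _)
  have h2 : ∫⁻ s in Icc 0 t, ‖deriv (fun s => f (γ s)) s‖ₑ ≤
      ENNReal.ofReal K * curveLength g γ := by
    rw [curveLength, ← MeasureTheory.lintegral_const_mul' _ _ ENNReal.ofReal_ne_top,
      ← MeasureTheory.restrict_Ioo_eq_restrict_Icc]
    refine (MeasureTheory.setLIntegral_mono_ae' measurableSet_Ioo
      (Eventually.of_forall hder)).trans ?_
    exact MeasureTheory.lintegral_mono_set (Ioo_subset_Icc_self.trans hsub)
  have h3 : ‖f (γ t) - f (γ 0)‖ₑ ≤ ENNReal.ofReal (K * L) :=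
    (h1.trans h2).trans (by rw [ENNReal.ofReal_mul hK]; gcongr)
  rw [Real.enorm_eq_ofReal_abs] at h3
  exact (ENNReal.ofReal_le_ofReal_iff (mul_nonneg hK hL)).1 h3

/-- A function that varies little along short curves turns Cauchy sequences for the Riemannian
distance into Cauchy sequences. -/
theorem cauchySeq_comp_of_curves {U : Set V} {g : V → V →L[ℝ] V →L[ℝ] ℝ} {s : ℕ → V}
    (hs : ∀ ε : ℝ≥0∞, 0 < ε → ∃ N, ∀ m ≥ N, ∀ k ≥ N, riemDist U g (s m) (s k) < ε)
    {f : V → ℝ} {K : ℝ} (hK : 0 ≤ K)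
    (hf : ∀ m, ∀ γ : ℝ → V, ContDiffOn ℝ 1 γ (Icc 0 1) → MapsTo γ (Icc 0 1) U → γ 0 = s m →
      ∀ L, 0 ≤ L → L ≤ 1 → curveLength g γ ≤ ENNReal.ofReal L → |f (γ 1) - f (γ 0)| ≤ K * L) :
    CauchySeq fun m => f (s m) := by
  refine Metric.cauchySeq_iff'.2 fun ε hε => ?_
  -- The cap `1` makes `hf` applicable, the second term gives `K * L < ε`, and `K + 1` avoids
  -- division by zero.
  set L := min 1 (ε / (2 * (K + 1)))
  have hLpos : 0 < L := lt_min one_pos (by positivity)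
  obtain ⟨N, hN⟩ := hs (ENNReal.ofReal L) (ENNReal.ofReal_pos.2 hLpos)
  refine ⟨N, fun m hm => ?_⟩
  have h := hN m hm N le_rfl
  simp only [riemDist, iInf_lt_iff] at h
  obtain ⟨γ, ⟨h1, h2, h3, h4⟩, hlen⟩ := h
  have h5 := hf m γ h1 h2 h3 L hLpos.le (min_le_left _ _) hlen.le
  rw [h3, h4, abs_sub_comm] at h5
  rw [Real.dist_eq]
  refine h5.trans_lt ?_
  have h6 : L ≤ ε / (2 * (K + 1)) := min_le_right _ _
  rw [le_div_iff₀ (by positivity)] at h6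
  nlinarith

/-- The Riemannian distance is locally bounded by a multiple of the norm distance. -/
theorem tendsto_riemDist_of_tendsto {U : Set V} (hU : IsOpen U) {g : V → V →L[ℝ] V →L[ℝ] ℝ}
    (hg : ContinuousOn g U) {s : ℕ → V} {p : V} (hp : p ∈ U) (hs : Tendsto s atTop (𝓝 p)) :
    Tendsto (fun m => riemDist U g (s m) p) atTop (𝓝 0) := by
  have hnorm : ∀ᶠ y in 𝓝 p, y ∈ U ∧ ‖g y‖ < ‖g p‖ + 1 :=
    (hU.eventually_mem hp).and
      ((hg.continuousAt (hU.mem_nhds hp)).norm.eventually_lt_const (lt_add_one _))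
  obtain ⟨r, hr, hball⟩ := Metric.eventually_nhds_iff_ball.1 hnorm
  set C := Real.sqrt (‖g p‖ + 1)
  have hle : ∀ x ∈ Metric.ball p r, riemDist U g x p ≤ ENNReal.ofReal (C * ‖p - x‖) := by
    intro x hx
    have hseg : ∀ t ∈ Icc (0 : ℝ) 1, x + t • (p - x) ∈ Metric.ball p r := fun t ht =>
      (convex_ball p r).add_smul_sub_mem hx (Metric.mem_ball_self hr) ht
    refine (iInf₂_le (fun t : ℝ => x + t • (p - x)) ⟨?_, fun t ht => (hball _ (hseg t ht)).1,
      by simp, by simp⟩).trans ?_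
    swap
    · fun_prop
    · have hd : ∀ t ∈ Icc (0 : ℝ) 1,
          derivWithin (fun t : ℝ => x + t • (p - x)) (Icc 0 1) t = p - x := fun t ht => by
        have : HasDerivAt (fun t : ℝ => x + t • (p - x)) (p - x) t := by
          simpa using ((hasDerivAt_id t).smul_const (p - x)).const_add x
        exact this.hasDerivWithinAt.derivWithin (uniqueDiffOn_Icc one_pos t ht)
      rw [curveLength]
      refine (MeasureTheory.setLIntegral_mono' (g := fun _ => ENNReal.ofReal (C * ‖p - x‖))
        measurableSet_Icc fun t ht => ?_).trans (by simp)
      rw [hd t ht]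
      refine ENNReal.ofReal_le_ofReal ((Real.sqrt_le_left (by positivity)).2 ?_)
      rw [mul_pow, Real.sq_sqrt (by positivity), _root_.sq]
      calc g (x + t • (p - x)) (p - x) (p - x) ≤ ‖g (x + t • (p - x)) (p - x) (p - x)‖ :=
            le_abs_self _
        _ ≤ ‖g (x + t • (p - x))‖ * ‖p - x‖ * ‖p - x‖ := ContinuousLinearMap.le_opNorm₂ _ _ _
        _ ≤ (‖g p‖ + 1) * (‖p - x‖ * ‖p - x‖) := by
            rw [mul_assoc]
            gcongr
            exact (hball _ (hseg t ht)).2.le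
  refine tendsto_of_tendsto_of_tendsto_of_le_of_le' tendsto_const_nhds (h :=
    fun m => ENNReal.ofReal (C * ‖p - s m‖)) ?_ (Eventually.of_forall fun _ => zero_le) ?_
  · have h1 : Tendsto (fun m => C * ‖p - s m‖) atTop (𝓝 0) := by
      have := ((tendsto_const_nhds (x := p)).sub hs).norm.const_mul C
      simpa using this
    simpa using ENNReal.tendsto_ofReal h1
  · filter_upwards [hs (Metric.ball_mem_nhds p hr)] with m hm using hle _ hm

end

end ChartGeometry

/-! ### Completeness. -/

namespace Heisenberg

noncomputable section

open ChartGeometry Set Filter Topology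

variable {n : ℕ} {q₀ φ₀ : ℝ} {φ : ℝ → ℝ}

theorem abs_le_inv_sqrt_mul_sqrt {c x y : ℝ} (hc : 0 < c) (h : c * x ^ 2 ≤ y) :
    |x| ≤ (Real.sqrt c)⁻¹ * Real.sqrt y := by
  rw [← div_eq_inv_mul, le_div_iff₀ (Real.sqrt_pos.2 hc), ← Real.sqrt_sq_eq_abs,
    ← Real.sqrt_mul (sq_nonneg x), mul_comm]
  exact Real.sqrt_le_sqrt h

theorem IsSolution.metric_apply (h : IsSolution n q₀ φ₀ (interval n q₀ φ₀) φ) {p : Amb n}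
    (hp : p.2 ∈ interval n q₀ φ₀) (u v : Amb n) :
    metric n φ p u v = φ p.2 * (xx u v + yy u v)
      + F n (φ p.2) / φ p.2 ^ (n - 1) * (zeta p u * zeta p v)
      + φ p.2 ^ (n - 1) * F n (φ p.2) * (dq n u * dq n v) := by
  rw [metric_eq_diagMetric, diagMetric_apply, (h.2 _ hp).deriv]

theorem xx_self_nonneg (v : Amb n) : 0 ≤ xx v v := by
  rw [xx_apply]; exact Finset.sum_nonneg fun i _ => mul_self_nonneg _

theorem yy_self_nonneg (v : Amb n) : 0 ≤ yy v v := by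
  rw [yy_apply]; exact Finset.sum_nonneg fun i _ => mul_self_nonneg _

theorem sigma_sq_le (v : Amb n) (i : Fin n) : sigma i v ^ 2 ≤ xx v v := by
  rw [xx_apply, _root_.sq]
  exact Finset.single_le_sum (f := fun i => sigma i v * sigma i v)
    (fun i _ => mul_self_nonneg _) (Finset.mem_univ i)

theorem rho_sq_le (v : Amb n) (i : Fin n) : rho i v ^ 2 ≤ yy v v := by
  rw [yy_apply, _root_.sq]
  exact Finset.single_le_sum (f := fun i => rho i v * rho i v)
    (fun i _ => mul_self_nonneg _) (Finset.mem_univ i)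

/-- The function `log φ` has gradient of length at most one. -/
theorem IsSolution.abs_fderiv_log_le (hn : 1 ≤ n) (hφ₀ : 0 < φ₀)
    (h : IsSolution n q₀ φ₀ (interval n q₀ φ₀) φ) {p : Amb n} (hp : p.2 ∈ interval n q₀ φ₀)
    (v : Amb n) : |fderiv ℝ (fun y : Amb n => Real.log (φ y.2)) p v| ≤
      1 * Real.sqrt (metric n φ p v v) := by
  have h0 := h.pos_of_mem hφ₀ hp
  have hF := F_pos n h0
  have hd : HasFDerivAt (fun y : Amb n => Real.log (φ y.2)) _ p :=
    ((h.2 _ hp).log h0.ne').comp_hasFDerivAt p (dq n).hasFDerivAt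
  rw [hd.fderiv, one_mul, ← Real.sqrt_sq_eq_abs]
  refine Real.sqrt_le_sqrt ?_
  rw [h.metric_apply hp]
  have h1 := mul_nonneg h0.le (add_nonneg (xx_self_nonneg v) (yy_self_nonneg v))
  have h2 : 0 ≤ F n (φ p.2) / φ p.2 ^ (n - 1) * (zeta p v * zeta p v) :=
    mul_nonneg (by positivity) (mul_self_nonneg _)
  -- After cancelling one factor `F n`, this is the bound `F n s ≤ s ^ (n + 1)` at `s = φ`.
  have h3 : (F n (φ p.2) / φ p.2) ^ 2 ≤ φ p.2 ^ (n - 1) * F n (φ p.2) := by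
    have h4 := F_le n h0
    have e : φ p.2 ^ (n + 1) = φ p.2 ^ (n - 1) * φ p.2 ^ 2 := by
      rw [← pow_add]; congr 1; omega
    rw [e] at h4
    rw [div_pow, div_le_iff₀ (by positivity)]
    nlinarith
  have h5 := mul_le_mul_of_nonneg_right h3 (mul_self_nonneg (dq n v))
  simp only [smul_apply, smul_eq_mul]
  nlinarith

/-- On a region where `φ` stays in a compact part of `(0, ∞)` the metric dominates a multiple of
the left-invariant metric `∑ (σᵢ² + ρᵢ²) + ζ² + dq²`. -/
theorem IsSolution.exists_le_metric (h : IsSolution n q₀ φ₀ (interval n q₀ φ₀) φ) {α β : ℝ}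
    (hα : 0 < α) : ∃ c, 0 < c ∧ ∀ p : Amb n, p.2 ∈ interval n q₀ φ₀ → φ p.2 ∈ Icc α β → ∀ v,
      c * (xx v v + yy v v + zeta p v ^ 2 + dq n v ^ 2) ≤ metric n φ p v v := by
  have hsub : Icc α β ⊆ Ioi 0 := fun x hx => hα.trans_le hx.1
  have hFc := (continuousOn_F n).mono hsub
  have hpc : ContinuousOn (fun s : ℝ => s ^ (n - 1)) (Icc α β) := by fun_prop
  have hmin : ContinuousOn (fun s => min s (min (F n s / s ^ (n - 1)) (s ^ (n - 1) * F n s)))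
      (Icc α β) :=
    continuousOn_id.inf ((hFc.div hpc fun x hx => pow_ne_zero _ (hsub hx).ne').inf (hpc.mul hFc))
  -- The constant is a positive lower bound for the three metric coefficients, written as functions
  -- of `s = φ`, on the compact interval.
  obtain ⟨c, hc, hcle⟩ := isCompact_Icc.exists_forall_le' hmin (a := 0) fun x hx => by
    have h0 : 0 < x := hsub hx
    have hF := F_pos n h0
    exact lt_min h0 (lt_min (by positivity) (by positivity))
  refine ⟨c, hc, fun p hp hr v => ?_⟩
  have hle := hcle _ hr
  simp only [le_min_iff] at hle
  have h1 := mul_le_mul_of_nonneg_right hle.1 (add_nonneg (xx_self_nonneg v) (yy_self_nonneg v))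
  have h2 := mul_le_mul_of_nonneg_right hle.2.1 (sq_nonneg (zeta p v))
  have h3 := mul_le_mul_of_nonneg_right hle.2.2 (sq_nonneg (dq n v))
  rw [h.metric_apply hp]
  nlinarith

theorem IsSolution.isCompleteOn (hn : 1 ≤ n) (hφ₀ : 0 < φ₀)
    (h : IsSolution n q₀ φ₀ (interval n q₀ φ₀) φ) :
    IsCompleteOn (manifoldM n q₀ φ₀) (metric n φ) := by
  intro s hsU hs
  have hUo : IsOpen (manifoldM n q₀ φ₀) := isOpen_snd_mem (isOpen_interval n q₀ φ₀)
  have hpos : ∀ p ∈ manifoldM n q₀ φ₀, 0 < φ p.2 := fun p hp => h.pos_of_mem hφ₀ hp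
  have hlogsm : ContDiffOn ℝ 1 (fun y : Amb n => Real.log (φ y.2)) (manifoldM n q₀ φ₀) :=
    (contDiffOn_comp_snd ((h.contDiffOn hφ₀).log fun q hq => (h.pos_of_mem hφ₀ hq).ne')).of_le
      (by exact_mod_cast le_top)
  have hlog : ∀ γ : ℝ → Amb n, ContDiffOn ℝ 1 γ (Icc 0 1) →
      MapsTo γ (Icc 0 1) (manifoldM n q₀ φ₀) → ∀ L, 0 ≤ L →
      curveLength (metric n φ) γ ≤ ENNReal.ofReal L → ∀ t ∈ Icc (0 : ℝ) 1,
      |Real.log (φ (γ t).2) - Real.log (φ (γ 0).2)| ≤ 1 * L := fun γ h1 h2 L hL hlen t ht =>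
    abs_sub_le_mul_of_curveLength_le hUo hlogsm h1 h2 zero_le_one hL hlen
      (fun r hr v => h.abs_fderiv_log_le hn hφ₀ (h2 hr) v) ht
  have hlogC : CauchySeq fun m => Real.log (φ (s m).2) :=
    cauchySeq_comp_of_curves (f := fun y => Real.log (φ y.2)) hs zero_le_one fun m γ h1 h2 _ L hL _ hlen =>
      hlog γ h1 h2 L hL hlen 1 (right_mem_Icc.2 zero_le_one)
  obtain ⟨R, hR⟩ := hlogC.isBounded_range.exists_norm_le
  have hR' : ∀ m, |Real.log (φ (s m).2)| ≤ R := fun m => hR _ ⟨m, rfl⟩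
  -- `R` bounds `|log φ|` on the sequence; the extra `1` allows for its variation along curves of
  -- length at most one.
  obtain ⟨c, hc, hcle⟩ := h.exists_le_metric (β := Real.exp (R + 1)) (Real.exp_pos (-(R + 1)))
  set K := (Real.sqrt c)⁻¹
  have hK : 0 ≤ K := inv_nonneg.2 (Real.sqrt_nonneg c)
  -- along curves of length at most one the four kinds of covectors are bounded
  have hcurve : ∀ m, ∀ γ : ℝ → Amb n, ContDiffOn ℝ 1 γ (Icc 0 1) →
      MapsTo γ (Icc 0 1) (manifoldM n q₀ φ₀) → γ 0 = s m → ∀ L, 0 ≤ L → L ≤ 1 →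
      curveLength (metric n φ) γ ≤ ENNReal.ofReal L → ∀ t ∈ Icc (0 : ℝ) 1, ∀ v,
      c * (xx v v + yy v v + zeta (γ t) v ^ 2 + dq n v ^ 2) ≤ metric n φ (γ t) v v := by
    intro m γ h1 h2 h3 L hL hL1 hlen t ht v
    refine hcle (γ t) (h2 ht) ?_ v
    have e1 := abs_le.1 (hlog γ h1 h2 L hL hlen t ht)
    have e2 := abs_le.1 (hR' m)
    rw [h3] at e1
    have h0 := hpos _ (h2 ht)
    exact ⟨(Real.le_log_iff_exp_le h0).1 (by linarith),
      (Real.log_le_iff_le_exp h0).1 (by linarith)⟩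
  -- linear functions with controlled differential are controlled
  have hlin : ∀ (ℓ : Amb n →L[ℝ] ℝ) (K' : ℝ), 0 ≤ K' → ∀ γ : ℝ → Amb n,
      ContDiffOn ℝ 1 γ (Icc 0 1) → MapsTo γ (Icc 0 1) (manifoldM n q₀ φ₀) → ∀ L, 0 ≤ L →
      curveLength (metric n φ) γ ≤ ENNReal.ofReal L →
      (∀ t ∈ Icc (0 : ℝ) 1, ∀ v, |ℓ v| ≤ K' * Real.sqrt (metric n φ (γ t) v v)) →
      ∀ t ∈ Icc (0 : ℝ) 1, |ℓ (γ t) - ℓ (γ 0)| ≤ K' * L :=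
    fun ℓ K' hK' γ h1 h2 L hL hlen hb t ht =>
      abs_sub_le_mul_of_curveLength_le hUo ℓ.contDiff.contDiffOn h1 h2 hK' hL hlen
        (fun r hr v => by rw [ℓ.fderiv]; exact hb r hr v) ht
  have hbasic : ∀ (ℓ : Amb n →L[ℝ] ℝ), (∀ v, ℓ v ^ 2 ≤ xx v v + yy v v + dq n v ^ 2) →
      ∀ m, ∀ γ : ℝ → Amb n, ContDiffOn ℝ 1 γ (Icc 0 1) →
      MapsTo γ (Icc 0 1) (manifoldM n q₀ φ₀) → γ 0 = s m → ∀ L, 0 ≤ L → L ≤ 1 →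
      curveLength (metric n φ) γ ≤ ENNReal.ofReal L →
      (∀ t ∈ Icc (0 : ℝ) 1, ∀ v, |ℓ v| ≤ K * Real.sqrt (metric n φ (γ t) v v)) := by
    intro ℓ hℓ m γ h1 h2 h3 L hL hL1 hlen t ht v
    refine abs_le_inv_sqrt_mul_sqrt hc (le_trans ?_ (hcurve m γ h1 h2 h3 L hL hL1 hlen t ht v))
    have := hℓ v
    gcongr
    linarith [sq_nonneg (zeta (γ t) v)]
  have hσ : ∀ i : Fin n, ∀ v : Amb n, sigma i v ^ 2 ≤ xx v v + yy v v + dq n v ^ 2 := fun i v => by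
    linarith [sigma_sq_le v i, yy_self_nonneg v, sq_nonneg (dq n v)]
  have hρ : ∀ i : Fin n, ∀ v : Amb n, rho i v ^ 2 ≤ xx v v + yy v v + dq n v ^ 2 := fun i v => by
    linarith [rho_sq_le v i, xx_self_nonneg v, sq_nonneg (dq n v)]
  have hq : ∀ v : Amb n, dq n v ^ 2 ≤ xx v v + yy v v + dq n v ^ 2 := fun v => by
    linarith [xx_self_nonneg v, yy_self_nonneg v]
  have hbasicC : ∀ (ℓ : Amb n →L[ℝ] ℝ), (∀ v, ℓ v ^ 2 ≤ xx v v + yy v v + dq n v ^ 2) →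
      CauchySeq fun m => ℓ (s m) := fun ℓ hℓ =>
    cauchySeq_comp_of_curves hs hK fun m γ h1 h2 h3 L hL hL1 hlen =>
      hlin ℓ K hK γ h1 h2 L hL hlen (hbasic ℓ hℓ m γ h1 h2 h3 L hL hL1 hlen) 1
        (right_mem_Icc.2 zero_le_one)
  choose X hX using fun i : Fin n => (hbasicC (sigma i) (hσ i)).isBounded_range.exists_norm_le
  have hX' : ∀ i m, |sigma i (s m)| ≤ X i := fun i m => hX i _ ⟨m, rfl⟩
  have hX0 : ∀ i, 0 ≤ X i := fun i => (abs_nonneg _).trans (hX' i 0)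
  -- This is the Lipschitz constant for `z`: along short curves `|xᵢ| ≤ X i + K`, and `dz = ∑ xᵢ dyᵢ
  -- - ζ` with each `dyᵢ` and `ζ` bounded by `K`.
  have hK' : 0 ≤ (∑ i, (X i + K)) * K + K :=
    add_nonneg (mul_nonneg (Finset.sum_nonneg fun i _ => add_nonneg (hX0 i) hK) hK) hK
  have hzC : CauchySeq fun m => dz n (s m) := by
    refine cauchySeq_comp_of_curves hs hK' fun m γ h1 h2 h3 L hL hL1 hlen => ?_
    refine hlin (dz n) _ hK' γ h1 h2 L hL hlen (fun t ht v => ?_) 1 (right_mem_Icc.2 zero_le_one)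
    have hx : ∀ i, |sigma i (γ t)| ≤ X i + K := fun i => by
      have e1 := hlin (sigma i) K hK γ h1 h2 L hL hlen
        (hbasic _ (hσ i) m γ h1 h2 h3 L hL hL1 hlen) t ht
      rw [h3] at e1
      have e2 := abs_sub_abs_le_abs_sub (sigma i (γ t)) (sigma i (s m))
      have e3 : K * L ≤ K := mul_le_of_le_one_right hK hL1
      linarith [hX' i m]
    have hζ : |zeta (γ t) v| ≤ K * Real.sqrt (metric n φ (γ t) v v) := by
      refine abs_le_inv_sqrt_mul_sqrt hc
        (le_trans ?_ (hcurve m γ h1 h2 h3 L hL hL1 hlen t ht v))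
      gcongr
      linarith [xx_self_nonneg v, yy_self_nonneg v, sq_nonneg (dq n v)]
    have hdz : dz n v = ∑ i, sigma i (γ t) * rho i v - zeta (γ t) v := by simp [zeta]
    rw [hdz, add_mul, Finset.sum_mul, Finset.sum_mul]
    refine (abs_sub _ _).trans (add_le_add ((Finset.abs_sum_le_sum_abs _ _).trans
      (Finset.sum_le_sum fun i _ => ?_)) hζ)
    rw [abs_mul, mul_assoc]
    exact mul_le_mul (hx i) (hbasic _ (hρ i) m γ h1 h2 h3 L hL hL1 hlen t ht v) (abs_nonneg _)
      (add_nonneg (hX0 i) hK)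
  choose x hx using fun i : Fin n => cauchySeq_tendsto_of_complete (hbasicC (sigma i) (hσ i))
  choose y hy using fun i : Fin n => cauchySeq_tendsto_of_complete (hbasicC (rho i) (hρ i))
  obtain ⟨z, hz⟩ := cauchySeq_tendsto_of_complete hzC
  obtain ⟨q, hq'⟩ := cauchySeq_tendsto_of_complete (hbasicC (dq n) hq)
  obtain ⟨l, hl⟩ := cauchySeq_tendsto_of_complete hlogC
  have hlim : Tendsto s atTop (𝓝 (((coord n).symm (x, y, z), q) : Amb n)) :=
    Tendsto.prodMk_nhds (Tendsto.prodMk_nhds (tendsto_pi_nhds.2 hx)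
      (Tendsto.prodMk_nhds (tendsto_pi_nhds.2 hy) hz)) hq'
  -- Passing to the limit in `q = q₀ + travelTime n φ₀ φ` shows that the limit of `q` is the time at
  -- which the value `exp l > 0` is attained, so it is not an endpoint of the interval.
  have hqI : q ∈ interval n q₀ φ₀ := by
    refine (mem_interval_iff n q₀ hφ₀ q).2 ⟨Real.exp l, Real.exp_pos l, ?_⟩
    have e1 : Tendsto (fun m => q₀ + travelTime n φ₀ (Real.exp (Real.log (φ (s m).2)))) atTop
        (𝓝 (q₀ + travelTime n φ₀ (Real.exp l))) :=
      (((hasDerivAt_travelTime n hφ₀ (Real.exp_pos l)).continuousAt.tendsto.comp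
        ((Real.continuous_exp.tendsto l).comp hl))).const_add q₀
    have e2 : ∀ m, q₀ + travelTime n φ₀ (Real.exp (Real.log (φ (s m).2))) = dq n (s m) :=
      fun m => by
        rw [Real.exp_log (hpos _ (hsU m))]
        exact (h.eq_add_travelTime hφ₀ (hsU m)).symm
    simp only [e2] at e1
    linarith [tendsto_nhds_unique e1 hq']
  refine ⟨_, hqI, tendsto_riemDist_of_tendsto hUo ?_ hqI hlim⟩
  rw [metric_eq_diagMetric]
  exact ((h.diagData hn hφ₀).isRiemannianMetricOn).smooth.continuousOn

end

end Heisenberg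

/-! ### The explicit form of the metric and the assembly of the soliton. -/

namespace Heisenberg

open ChartGeometry

variable {n : ℕ} {q₀ φ₀ : ℝ} {φ : ℝ → ℝ}

theorem IsSolution.metric_eq_in_terms_of_phi (hφ₀ : 0 < φ₀)
    (h : IsSolution n q₀ φ₀ (interval n q₀ φ₀) φ) {p : Amb n} (hp : p ∈ manifoldM n q₀ φ₀) :
    metric n φ p = (∑ i : Fin n, φ p.2 • (sq (sigma i) + sq (rho i)))
      + (F n (φ p.2) / φ p.2 ^ (n - 1)) • sq (zeta p)
      + (φ p.2 ^ (n - 1) / F n (φ p.2)) • sq (fderiv ℝ (fun x : Amb n => φ x.2) p) := by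
  have hF := (F_pos n (h.pos_of_mem hφ₀ hp)).ne'
  have hd : HasFDerivAt (fun x : Amb n => φ x.2) (F n (φ p.2) • dq n) p :=
    (h.2 _ hp).comp_hasFDerivAt p (dq n).hasFDerivAt
  rw [metric, (h.2 _ hp).deriv, hd.fderiv]
  congr 1
  refine ContinuousLinearMap.ext fun u => ContinuousLinearMap.ext fun v => ?_
  simp [sq]
  field_simp

theorem IsSolution.isGradientKahlerRicciSoliton (hn : 1 ≤ n) (hφ₀ : 0 < φ₀)
    (h : IsSolution n q₀ φ₀ (interval n q₀ φ₀) φ) (κ : ℝ) :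
    IsGradientKahlerRicciSoliton (manifoldM n q₀ φ₀) (metric n φ) (cplx n φ)
      (fun p => -φ p.2 + κ) (-1) := by
  have D := h.diagData hn hφ₀
  have hpos : ∀ q ∈ interval n q₀ φ₀, 0 < φ q ^ (n - 1) := fun q hq =>
    pow_pos (h.pos_of_mem hφ₀ hq) _
  have hm : ContDiffOn ℝ ∞ (fun q => φ q ^ (n - 1)) (interval n q₀ φ₀) :=
    (h.contDiffOn hφ₀).pow (n - 1)
  have hC : ∀ q ∈ interval n q₀ φ₀, φ q ^ (n - 1) * deriv φ q =
      (φ q ^ (n - 1)) ^ 2 * (deriv φ q / φ q ^ (n - 1)) := fun q hq => by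
    have := (hpos q hq).ne'
    field_simp
  refine ⟨?_, ?_, fun p hp u v => h.soliton_equation hn hφ₀ κ hp u v, fun p hp u => ?_⟩
  · rw [metric_eq_diagMetric, cplx_eq_diagCplx]
    refine D.isKahlerOn hm hpos hC fun q hq => ?_
    have h1 := (hpos q hq).ne'
    have h2 := (h.pos_of_mem hφ₀ hq).ne'
    rw [(h.2 q hq).deriv]
    field_simp
  · exact (contDiffOn_comp_snd (h.contDiffOn hφ₀)).neg.add contDiffOn_const
  · rw [metric_eq_diagMetric, cplx_eq_diagCplx]
    -- Here `m * B = φ'`, so the derivative of `-φ + κ` is `-1` times `m * B`.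
    refine D.gradient_holomorphic hm hpos hC (f := fun q => -φ q + κ) (κ := -1)
      (fun q hq => ?_) hp u
    have h1 := (hpos q hq).ne'
    refine ((h.2 q hq).neg.add_const κ).congr_deriv ?_
    rw [(h.2 q hq).deriv]
    field_simp

end Heisenberg

open ChartGeometry Heisenberg in
theorem theorem4p2 (n : ℕ) (hn : 1 ≤ n) (q₀ φ₀ : ℝ) (hφ₀ : 0 < φ₀) :
    (∃ φ : ℝ → ℝ, IsSolution n q₀ φ₀ (interval n q₀ φ₀) φ) ∧
    ∀ φ : ℝ → ℝ, IsSolution n q₀ φ₀ (interval n q₀ φ₀) φ →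
      (∀ (I : Set ℝ) (ψ : ℝ → ℝ), IsOpen I → I.OrdConnected → q₀ ∈ I →
        IsSolution n q₀ φ₀ I ψ → I ⊆ interval n q₀ φ₀ ∧ Set.EqOn ψ φ I) ∧
      Set.BijOn φ (interval n q₀ φ₀) (Set.Ioi 0) ∧
      (∀ p ∈ manifoldM n q₀ φ₀, metric n φ p =
        (∑ i : Fin n, φ p.2 • (sq (sigma i) + sq (rho i)))
          + (F n (φ p.2) / φ p.2 ^ (n - 1)) • sq (zeta p)
          + (φ p.2 ^ (n - 1) / F n (φ p.2)) • sq (fderiv ℝ (fun x : Amb n => φ x.2) p)) ∧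
      IsCompleteOn (manifoldM n q₀ φ₀) (metric n φ) ∧
      ∀ c : ℝ, IsGradientKahlerRicciSoliton (manifoldM n q₀ φ₀) (metric n φ) (cplx n φ)
        (fun p => -φ p.2 + c) (-1) :=
  ⟨exists_isSolution n q₀ hφ₀, fun _ h => ⟨fun _ _ hIo hI hq₀ hψ => h.maximal hφ₀ hIo hI hq₀ hψ,
    h.bijOn hφ₀, fun _ hp => h.metric_eq_in_terms_of_phi hφ₀ hp, h.isCompleteOn hn hφ₀,
    h.isGradientKahlerRicciSoliton hn hφ₀⟩⟩
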